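/- Let $D^3\subset\mathbb R^3$ be a closed round ball, with coordinates $(x,y,z)$. A *diagram* consists of two disjoint oriented properly embedded arcs $T\subset D^3$ and a straight (dotted) segment $\gamma$ in the interior of $D^3$ joining one arc to the other and otherwise disjoint from $T$. It represents the following surface in $S^1\times D^3$: take the pair of annuli $S^1\times T$ and add a handle, i.e. take a $3$-dimensional $1$-handle $h\cong D^1\times D^2$ embedded in the interior of $S^1\times D^3$ that meets $S^1\times T$ exactly in its attaching region $\partial D^1\times D^2$ and has core $\{1\}\times\gamma$, remove the attaching region from $S^1\times T$, and glue in $D^1\times\partial D^2$ (the corners being rounded). The handle is untwisted, i.e. it respects the orientation of $S^1\times T$. Concretely, the handle is obtained as follows: between the sheets $\{y=\pm1,\ z=0\}$ of $S^1\times\mathbb R^3$ let $h_0$ be the tube-shaped handle with core $\{1\}\times\{(0,y,0):|y|\le 1\}$, contained in $\{z=0\}$, whose cross-section at height $y$ is a round disc around $(1,(0,y,0))$ in the $S^1$- and $x$-directions, and which flares out at $y=\pm1$ so that its side meets the sheets smoothly; then $h$ is the image of $h_0$ under $\mathrm{id}_{S^1}\times\psi$ for the diffeomorphism $\psi$ of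 $\mathbb R^3$ named below, which takes a neighbourhood of the core segment in the sheets $\{y=\pm1,\ z=0\}$ to $T$. Consider the following diagrams; the arcs of all of them have the same four end points, the points of $\partial D^3$ with $z=0$ and $y=\pm x$. * (a1): two horizontal arcs $y=\pm f(x)$ in the plane $z=0$, where $f$ is positive, even and smooth, $f(x)=1$ for $|x|\le 2$ and $f(x)=|x|$ for $|x|\ge 3$. The upper one is oriented to the right and the lower one to the left, and $\gamma$ is the vertical segment from $(0,-1,0)$ to $(0,1,0)$; $\psi=\mathrm{id}$. * (a2): two vertical arcs $x=\pm f(y)$ in the plane $z=0$, the left one oriented downwards and the right one upwards (so that the end points have the same orientation as in (a1)), and $\gamma$ the horizontal segment between $(-1,0,0)$ and $(1,0,0)$; $\psi$ is the quarter turn $Q(x,y,z)=(-y,x,z)$. * (b1) and (b2): the arcs of (a2) with a half twist $\tau_+$, respectively $\tau_-$, around the $y$-axis performed in $|y|\le 1/2$, where $\tau_\pm$ rotates the plane at height $y$ by $(x,z)\mapsto(x\cos\theta\mp z\sin\theta,\ \pm x\sin\theta+z\cos\theta)$ with $\theta$ increasing smoothly from $0$ to $\pi$; i.e. the two crossings of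 an arc from the lower left to the upper right end point with an arc from the upper left to the lower right end point (the first passes below the second, with respect to $z$, in (b1) and above it in (b2)); $\gamma$ is the segment between $(0,0,-1)$ and $(0,0,1)$, which joins the two arcs at the crossing; both arcs are oriented from left to right; $\psi=\tau_\pm\circ Q$. Then, in $S^1\times D^3$: 1. the surface represented by (a1) is smoothly ambient isotopic, relative to the boundary, to the surface represented by (a2); 2. the surface represented by (b1) is smoothly ambient isotopic, relative to the boundary, to the surface represented by (b2), i.e. the handle lets one switch the crossing; 3. the same as in 2 holds for the crossings with both arcs oriented upwards and with a handle that respects this orientation, i.e. for the diagrams (b1) and (b2) and their handles after a quarter turn $Q$ of the diagrams. -/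

import Mathlib

open Set
open scoped Manifold ContDiff

noncomputable section

namespace CrossingSwitch

/-- Euclidean `3`-space, the ambient space of the disc `D³`. -/
abbrev E3 : Type := EuclideanSpace ℝ (Fin 3)

/-- The product `S¹ × ℝ³`, the ambient space of `S¹ × D³`. -/
abbrev X4 : Type := Circle × E3

/-- The product smooth structure on `S¹ × ℝ³`. -/
abbrev I4 : ModelWithCorners ℝ (EuclideanSpace ℝ (Fin 1) × E3)
    (ModelProd (EuclideanSpace ℝ (Fin 1)) E3) := (𝓡 1).prod 𝓘(ℝ, E3)

/-- The disc `D³`: the closed ball of radius `10`. -/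
def disc : Set E3 := Metric.closedBall 0 10

/-- `S` and `S'` (subsets of `S¹ × D³`) are smoothly isotopic in `S¹ × D³` relative to the boundary:
there is a smooth family `Φ s` of diffeomorphisms, `Φ 0` is the identity, `Φ 1` carries `S` to `S'`,
and all `Φ s` are the identity near (and outside) the boundary of `S¹ × D³`.
(The isotopy is the restriction of the family to `0 ≤ s ≤ 1`.) -/
def IsotopicRelBoundary (S S' : Set X4) : Prop :=
  ∃ Φ : ℝ → (X4 ≃ₘ^∞⟮I4, I4⟯ X4),
    ContMDiff (𝓘(ℝ, ℝ).prod I4) I4 ∞ (fun q : ℝ × X4 => Φ q.1 q.2) ∧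
    (∀ q, Φ 0 q = q) ∧
    Φ 1 '' S = S' ∧
    ∃ r < (10 : ℝ), ∀ (s : ℝ) (q : X4), r ≤ ‖q.2‖ → Φ s q = q

/-! ### Diagrams with a dotted line -/

/-- A diagram in `D³`: arcs, and a straight dotted line from `a` to `b` joining two of them. The arcs
are oriented; `da` and `db` are positive tangent vectors at `a` and `b`. -/
structure Diagram where
  arcs : Set E3
  a : E3
  b : E3
  da : E3
  db : E3

/-- The surface `S¹ × arcs`; for two arcs, a pair of annuli. -/
def Diagram.annuli (P : Diagram) : Set X4 := {q | q.2 ∈ P.arcs}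

/-! ### The standard handle, between the sheets `y = -1` and `y = 1` of `{z = 0}` -/

/-- Squared distance from the line `{1} × (y-axis)`, the one in which the core of the handle lies
(distances in the circle are measured along chords). -/
def rho (q : X4) : ℝ := ‖(q.1 : ℂ) - 1‖ ^ 2 + (q.2 0) ^ 2

/-- The profile of the handle: `r - 2` for `r ≤ 9/4`, strictly increasing for `r ≤ 3`, and constantly
`1` for `r ≥ 3`. It makes the handle flare out at its two ends, so that its side meets the sheets
tangentially: the corners are rounded. -/
def profile (r : ℝ) : ℝ :=
  (r - 2) + Real.smoothTransition ((r - 9 / 4) / (3 / 4)) * (3 - r)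

/-- The standard `3`-dimensional `1`-handle `D¹ × D²`: over each height `y ∈ [-1, 1]` it has a round
disc around `(1, (0, y, 0))` as its cross-section. -/
def solidHandle : Set X4 :=
  {q | q.2 2 = 0 ∧ rho q ≤ 3 ∧ (q.2 1) ^ 2 ≤ 1 ∧ profile (rho q) ≤ (q.2 1) ^ 2}

/-- The part `D¹ × S¹` of the boundary of the standard handle. -/
def tube : Set X4 := {q | q.2 2 = 0 ∧ rho q ≤ 3 ∧ (q.2 1) ^ 2 = profile (rho q)}

/-- The box of `ℝ³` above which the standard handle and its collar lie. -/
def box : Set E3 := {p | (p 0) ^ 2 < 4 ∧ (p 1) ^ 2 < 4 ∧ (p 2) ^ 2 < 1}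

/-- A handle as specified by a diagram with a dotted line: the standard handle, placed in `S¹ × D³` by
the identity of `S¹` times a diffeomorphism of `ℝ³`. The surface corresponds in the box to the sheets
`y = ± 1`, so the handle meets it exactly in the attaching region; the core of the handle is the
dotted line, in `{1} × D³`; and the handle is untwisted, i.e. it respects the orientation of the
surface: the two oriented arcs correspond at the ends of the core to antiparallel directions of the
two sheets. -/
structure Handle (P : Diagram) where
  toDiff : E3 ≃ₘ^∞⟮𝓘(ℝ, E3), 𝓘(ℝ, E3)⟯ E3
  inside : toDiff '' box ⊆ Metric.ball 0 10
  sheets : ∀ p ∈ box, toDiff p ∈ P.arcs ↔ (p 1) ^ 2 = 1 ∧ p 2 = 0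
  core : toDiff '' segment ℝ !₂[0, -1, 0] !₂[0, 1, 0] = segment ℝ P.a P.b
  core_left : toDiff !₂[0, -1, 0] = P.a
  core_right : toDiff !₂[0, 1, 0] = P.b
  untwisted : ∃ ka kb : ℝ, 0 < ka * kb ∧
    HasDerivAt (fun x : ℝ => toDiff !₂[x, -1, 0]) (-(ka • P.da)) 0 ∧
    HasDerivAt (fun x : ℝ => toDiff !₂[x, 1, 0]) (kb • P.db) 0

/-- The placement of the handle in `S¹ × ℝ³`. -/
def Handle.place {P : Diagram} (h : Handle P) (q : X4) : X4 := (q.1, h.toDiff q.2)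

/-- The surface with the added handle: cut the attaching region out of the annuli, and glue in the
complementary part of the boundary of the handle. -/
def addHandle {P : Diagram} (h : Handle P) : Set X4 :=
  (P.annuli \ h.place '' solidHandle) ∪ h.place '' tube

/-! ### The diagrams (a1), (a2) -/

/-- The function `s ↦ 1` for `s ≤ 4` and `s ↦ s` for `s ≥ 9`, smoothly interpolated. -/
def arcShape (s : ℝ) : ℝ := 1 + (s - 1) * Real.smoothTransition ((s - 4) / 5)

/-- (a1): the two horizontal arcs `y = ± √(arcShape (x²))` of the plane `z = 0`, joined by a vertical
dotted line. The upper arc runs to the right, the lower one to the left. -/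
def diagramA1 : Diagram where
  arcs := {p | p ∈ disc ∧ p 2 = 0 ∧ (p 1) ^ 2 = arcShape ((p 0) ^ 2)}
  a := !₂[0, -1, 0]
  b := !₂[0, 1, 0]
  da := !₂[-1, 0, 0]
  db := !₂[1, 0, 0]

/-- (a2): the two vertical arcs `x = ± √(arcShape (y²))` of the plane `z = 0`, joined by a horizontal
dotted line. They have the same four ends, with the same boundary orientation, as the arcs of (a1):
the left arc runs down, the right one up. -/
def diagramA2 : Diagram where
  arcs := {p | p ∈ disc ∧ p 2 = 0 ∧ (p 0) ^ 2 = arcShape ((p 1) ^ 2)}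
  a := !₂[1, 0, 0]
  b := !₂[-1, 0, 0]
  da := !₂[0, 1, 0]
  db := !₂[0, -1, 0]

/-- The quarter turn `(x, y, z) ↦ (-y, x, z)` of the plane of the diagrams. -/
def quarterTurn : E3 ≃ₗᵢ[ℝ] E3 where
  toFun p := !₂[-p 1, p 0, p 2]
  invFun p := !₂[p 1, -p 0, p 2]
  left_inv p := by ext i; fin_cases i <;> simp
  right_inv p := by ext i; fin_cases i <;> simp
  map_add' p q := by ext i; fin_cases i <;> simp; ring
  map_smul' c p := by ext i; fin_cases i <;> simp
  norm_map' p := by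
    simp [EuclideanSpace.norm_eq, Fin.sum_univ_three]
    ring_nf

/-- A quarter turn as a diffeomorphism of `ℝ³`. -/
def quarterTurnDiff : E3 ≃ₘ^∞⟮𝓘(ℝ, E3), 𝓘(ℝ, E3)⟯ E3 :=
  quarterTurn.toContinuousLinearEquiv.toDiffeomorph

@[simp] theorem quarterTurnDiff_apply (p : E3) : quarterTurnDiff p = quarterTurn p := rfl

theorem quarterTurn_apply (p : E3) : quarterTurn p = !₂[-p 1, p 0, p 2] := rfl

/-! ### The diagrams (b1), (b2) -/

/-- The angle of the half twist: `0` for `y ≤ -1/2` and `π` for `y ≥ 1/2`. -/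
def angle (y : ℝ) : ℝ := Real.pi * Real.smoothTransition (y + 1 / 2)

/-- Rotation of the plane at height `y` by `c * angle y` around the `y`-axis. -/
def twistFun (c : ℝ) (p : E3) : E3 :=
  !₂[Real.cos (c * angle (p 1)) * p 0 - Real.sin (c * angle (p 1)) * p 2, p 1,
    Real.sin (c * angle (p 1)) * p 0 + Real.cos (c * angle (p 1)) * p 2]

theorem twistFun_neg (c : ℝ) (p : E3) : twistFun (-c) (twistFun c p) = p := by
  have h := Real.sin_sq_add_cos_sq (c * angle (p 1))
  ext i
  fin_cases i
  · simp [twistFun]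
    linear_combination (p 0) * h
  · simp [twistFun]
  · simp [twistFun]
    linear_combination (p 2) * h

theorem angle_contDiff : ContDiff ℝ ∞ angle := by
  unfold angle
  exact contDiff_const.mul (Real.smoothTransition.contDiff.comp (contDiff_id.add contDiff_const))

theorem twistFun_contDiff (c : ℝ) : ContDiff ℝ ∞ (twistFun c) := by
  have hp : ∀ i : Fin 3, ContDiff ℝ ∞ (fun p : E3 => p i) := fun i =>
    contDiff_euclidean.1 contDiff_id i
  have ha : ContDiff ℝ ∞ (fun p : E3 => c * angle (p 1)) :=
    contDiff_const.mul (angle_contDiff.comp (hp 1))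
  rw [contDiff_euclidean]
  intro i
  fin_cases i
  · exact ((Real.contDiff_cos.comp ha).mul (hp 0)).sub ((Real.contDiff_sin.comp ha).mul (hp 2))
  · exact hp 1
  · exact ((Real.contDiff_sin.comp ha).mul (hp 0)).add ((Real.contDiff_cos.comp ha).mul (hp 2))

/-- The two half twists of `ℝ³` around the `y`-axis, in opposite directions. -/
def halfTwist (σ : ℤˣ) : E3 ≃ₘ^∞⟮𝓘(ℝ, E3), 𝓘(ℝ, E3)⟯ E3 where
  toFun := twistFun ((σ : ℤ) : ℝ)
  invFun := twistFun (-((σ : ℤ) : ℝ))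
  left_inv := twistFun_neg _
  right_inv p := by simpa using twistFun_neg (-((σ : ℤ) : ℝ)) p
  contMDiff_toFun := (twistFun_contDiff _).contMDiff
  contMDiff_invFun := (twistFun_contDiff _).contMDiff

/-- (b1) for `σ = 1` and (b2) for `σ = -1`: the vertical arcs of (a2) with a half twist, i.e. a crossing
of an arc from the lower left to the upper right and an arc from the upper left to the lower right.
For `σ = 1` the first one passes below the second one, and for `σ = -1` above it. At the crossing
the two arcs are joined by a dotted line perpendicular to the plane of the diagram.
Both arcs run from left to right. -/
def diagramB (σ : ℤˣ) : Diagram where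
  arcs := halfTwist σ '' diagramA2.arcs
  a := !₂[0, 0, ((σ : ℤ) : ℝ)]
  b := !₂[0, 0, -((σ : ℤ) : ℝ)]
  da := !₂[2 * Real.pi, -1, 0]
  db := !₂[2 * Real.pi, 1, 0]

/-- A diagram after a quarter turn. A crossing with both arcs running from left to right becomes a
crossing with both arcs running upwards. -/
def Diagram.turn (P : Diagram) : Diagram where
  arcs := quarterTurn '' P.arcs
  a := quarterTurn P.a
  b := quarterTurn P.b
  da := quarterTurn P.da
  db := quarterTurn P.db

/-! ### The handles -/

theorem box_norm {p : E3} (hp : p ∈ box) : ‖p‖ < 10 := by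
  obtain ⟨h0, h1, h2⟩ := hp
  rw [EuclideanSpace.norm_eq, Real.sqrt_lt' (by norm_num)]
  simp only [Fin.sum_univ_three, Real.norm_eq_abs, sq_abs]
  linarith

theorem twistFun_norm (c : ℝ) (p : E3) : ‖twistFun c p‖ = ‖p‖ := by
  have h := Real.sin_sq_add_cos_sq (c * angle (p 1))
  rw [EuclideanSpace.norm_eq, EuclideanSpace.norm_eq]
  congr 1
  simp only [Fin.sum_univ_three, Real.norm_eq_abs, sq_abs, twistFun]
  simp
  linear_combination ((p 0) ^ 2 + (p 2) ^ 2) * h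

theorem segment_image (f : E3 → E3) (a b : E3)
    (h : ∀ t : ℝ, f (AffineMap.lineMap !₂[0, -1, 0] !₂[0, 1, 0] t) = AffineMap.lineMap a b t) :
    f '' segment ℝ !₂[0, -1, 0] !₂[0, 1, 0] = segment ℝ a b := by
  rw [segment_eq_image_lineMap, segment_eq_image_lineMap, image_image]
  exact image_congr fun t _ => h t

theorem hasDerivAt_vec {f0 f1 f2 : ℝ → ℝ} {d0 d1 d2 x : ℝ} (h0 : HasDerivAt f0 d0 x)
    (h1 : HasDerivAt f1 d1 x) (h2 : HasDerivAt f2 d2 x) :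
    HasDerivAt (fun t => (!₂[f0 t, f1 t, f2 t] : E3)) !₂[d0, d1, d2] x := by
  have h : HasDerivAt (fun t => (![f0 t, f1 t, f2 t] : Fin 3 → ℝ)) ![d0, d1, d2] x := by
    rw [hasDerivAt_pi]
    intro i
    fin_cases i
    exacts [h0, h1, h2]
  exact ((PiLp.continuousLinearEquiv 2 ℝ (fun _ : Fin 3 => ℝ)).symm.toContinuousLinearMap
    |>.hasFDerivAt).comp_hasDerivAt x h

theorem hasDerivAt_angle : HasDerivAt angle (2 * Real.pi) 0 := by
  set g : ℝ := expNegInvGlue (1 / 2) with hgdef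
  have hpos : 0 < g := expNegInvGlue.pos_of_pos (by norm_num)
  have hhalf : (1 : ℝ) - 1 / 2 = 1 / 2 := by norm_num
  have hg : HasDerivAt expNegInvGlue (4 * g) (1 / 2) := by
    have h := expNegInvGlue.hasDerivAt_polynomial_eval_inv_mul 1 (1 / 2)
    simp only [Polynomial.eval_one, one_mul, Polynomial.derivative_one, sub_zero, mul_one,
      Polynomial.eval_pow, Polynomial.eval_X] at h
    convert h using 1
    norm_num [hgdef]
  have hg' : HasDerivAt (fun x : ℝ => expNegInvGlue (1 - x)) (-(4 * g)) (1 / 2) := by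
    have h1 : HasDerivAt (fun x : ℝ => 1 - x) (-1) (1 / 2) := by
      simpa using (hasDerivAt_id (1 / 2 : ℝ)).const_sub 1
    have h2 : HasDerivAt expNegInvGlue (4 * g) (1 - 1 / 2) := by rw [hhalf]; exact hg
    have h := h2.comp (1 / 2 : ℝ) h1
    rw [mul_neg_one] at h
    exact h
  have hs : HasDerivAt Real.smoothTransition 2 (1 / 2) := by
    have h := hg.div (hg.add hg') (by
      simp only [Pi.add_apply, hhalf]
      rw [← hgdef]
      positivity)
    simp only [Pi.add_apply, hhalf, ← hgdef] at h
    have e : (4 * g * (g + g) - g * (4 * g + -(4 * g))) / (g + g) ^ 2 = 2 := by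
      field_simp
      ring
    rw [e] at h
    exact h
  have h3 : HasDerivAt (fun y : ℝ => y + 1 / 2) 1 0 := (hasDerivAt_id 0).add_const _
  have hs' : HasDerivAt Real.smoothTransition 2 (0 + 1 / 2) := by rw [zero_add]; exact hs
  have h := (hs'.comp (0 : ℝ) h3).const_mul Real.pi
  rw [mul_one, mul_comm Real.pi 2] at h
  exact h

theorem angle_zero : angle 0 = Real.pi / 2 := by
  set g : ℝ := expNegInvGlue (1 / 2) with hgdef
  have hpos : 0 < g := expNegInvGlue.pos_of_pos (by norm_num)
  have hhalf : (1 : ℝ) - 1 / 2 = 1 / 2 := by norm_num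
  have h : Real.smoothTransition (1 / 2) = 1 / 2 := by
    unfold Real.smoothTransition
    rw [hhalf, ← hgdef]
    field_simp
    norm_num
  simp only [angle, zero_add, h]
  ring

theorem arcShape_of_lt {s : ℝ} (hs : s < 4) : arcShape s = 1 := by
  rw [arcShape, Real.smoothTransition.zero_of_nonpos (by linarith)]
  ring

theorem diagramA1_sheets {p : E3} (hp : p ∈ box) :
    p ∈ diagramA1.arcs ↔ (p 1) ^ 2 = 1 ∧ p 2 = 0 := by
  have h1 : p ∈ disc := by
    simpa [disc] using (box_norm hp).le
  simp only [diagramA1, Set.mem_ofPred_eq, h1, true_and, arcShape_of_lt hp.1]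
  tauto

theorem quarterTurn_diagramA1 (p : E3) : quarterTurn p ∈ diagramA2.arcs ↔ p ∈ diagramA1.arcs := by
  have h : quarterTurn p ∈ disc ↔ p ∈ disc := by
    simp [disc]
  simp only [diagramA1, diagramA2, Set.mem_ofPred_eq, h]
  simp [quarterTurn_apply]

theorem quarterTurn_vec (x y z : ℝ) : quarterTurn !₂[x, y, z] = !₂[-y, x, z] := by
  simp [quarterTurn_apply]

/-- The handle of (a1). -/
def handleA1 : Handle diagramA1 where
  toDiff := Diffeomorph.refl _ _ _
  inside := by
    rintro _ ⟨p, hp, rfl⟩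
    simpa using box_norm hp
  sheets p hp := diagramA1_sheets hp
  core := by simp [diagramA1]
  core_left := rfl
  core_right := rfl
  untwisted := by
    refine ⟨1, 1, by norm_num, ?_, ?_⟩
    · refine (hasDerivAt_vec (hasDerivAt_id (0 : ℝ)) (hasDerivAt_const (0 : ℝ) (-1 : ℝ))
        (hasDerivAt_const (0 : ℝ) (0 : ℝ))).congr_deriv ?_
      rw [one_smul]
      ext i; fin_cases i <;> simp [diagramA1]
    · refine (hasDerivAt_vec (hasDerivAt_id (0 : ℝ)) (hasDerivAt_const (0 : ℝ) (1 : ℝ))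
        (hasDerivAt_const (0 : ℝ) (0 : ℝ))).congr_deriv ?_
      rw [one_smul]
      rfl

/-- The handle of (a2). -/
def handleA2 : Handle diagramA2 where
  toDiff := quarterTurnDiff
  inside := by
    rintro _ ⟨p, hp, rfl⟩
    simpa using box_norm hp
  sheets p hp := (quarterTurn_diagramA1 p).trans (diagramA1_sheets hp)
  core := by
    refine segment_image _ _ _ fun t => ?_
    ext i; fin_cases i <;> simp [quarterTurn_apply, diagramA2, AffineMap.lineMap_apply]
    ring
  core_left := by simp [quarterTurn_vec, diagramA2]
  core_right := by simp [quarterTurn_vec, diagramA2]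
  untwisted := by
    refine ⟨-1, -1, by norm_num, ?_, ?_⟩
    · have h := hasDerivAt_vec (hasDerivAt_const (0 : ℝ) (1 : ℝ)) (hasDerivAt_id (0 : ℝ))
        (hasDerivAt_const (0 : ℝ) (0 : ℝ))
      convert h using 1
      · funext x; simp [quarterTurn_vec]
      · ext i; fin_cases i <;> simp [diagramA2]
    · have h := hasDerivAt_vec (hasDerivAt_const (0 : ℝ) (-1 : ℝ)) (hasDerivAt_id (0 : ℝ))
        (hasDerivAt_const (0 : ℝ) (0 : ℝ))
      convert h using 1
      · funext x; simp [quarterTurn_vec]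
      · ext i; fin_cases i <;> simp [diagramA2]

theorem halfTwist_apply (σ : ℤˣ) (p : E3) : halfTwist σ p = twistFun ((σ : ℤ) : ℝ) p := rfl

theorem cos_sign (σ : ℤˣ) : Real.cos (((σ : ℤ) : ℝ) * (Real.pi / 2)) = 0 := by
  rcases Int.units_eq_one_or σ with rfl | rfl <;> simp

theorem sin_sign (σ : ℤˣ) : Real.sin (((σ : ℤ) : ℝ) * (Real.pi / 2)) = ((σ : ℤ) : ℝ) := by
  rcases Int.units_eq_one_or σ with rfl | rfl <;> simp

theorem sign_mul_self (σ : ℤˣ) : ((σ : ℤ) : ℝ) * ((σ : ℤ) : ℝ) = 1 := by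
  rcases Int.units_eq_one_or σ with rfl | rfl <;> simp

/-- The half twist along a line parallel to the `y`-axis in the plane `z = 0`. -/
theorem hasDerivAt_twist (σ : ℤˣ) (u : ℝ) :
    HasDerivAt (fun y : ℝ => halfTwist σ !₂[u, y, 0]) !₂[-(u * (2 * Real.pi)), 1, 0] 0 := by
  have hα : HasDerivAt (fun y => ((σ : ℤ) : ℝ) * angle y) (((σ : ℤ) : ℝ) * (2 * Real.pi)) 0 :=
    hasDerivAt_angle.const_mul _
  have h := hasDerivAt_vec (hα.cos.mul_const u) (hasDerivAt_id (0 : ℝ)) (hα.sin.mul_const u)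
  convert h using 1
  · funext y
    simp [halfTwist_apply, twistFun]
  · ext i
    fin_cases i
    · simp only [angle_zero, sin_sign]
      simp
      linear_combination (-(2 * Real.pi * u)) * sign_mul_self σ
    · simp
    · simp [angle_zero, cos_sign]

/-- The handle of (b1) for `σ = 1`, of (b2) for `σ = -1`: that of (a2), carried along by the half
twist. -/
def handleB (σ : ℤˣ) : Handle (diagramB σ) where
  toDiff := quarterTurnDiff.trans (halfTwist σ)
  inside := by
    rintro _ ⟨p, hp, rfl⟩
    simpa [halfTwist_apply, twistFun_norm] using box_norm hp
  sheets p hp := by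
    have h : (quarterTurnDiff.trans (halfTwist σ)) p ∈ (diagramB σ).arcs ↔
        quarterTurn p ∈ diagramA2.arcs := (halfTwist σ).injective.mem_set_image
    exact h.trans ((quarterTurn_diagramA1 p).trans (diagramA1_sheets hp))
  core := by
    refine segment_image _ _ _ fun t => ?_
    have hl : (AffineMap.lineMap !₂[0, -1, 0] !₂[0, 1, 0] t : E3) = !₂[0, 2 * t - 1, 0] := by
      ext i; fin_cases i <;> simp [AffineMap.lineMap_apply]
      ring
    rw [hl]
    simp only [Diffeomorph.coe_trans, Function.comp_apply, quarterTurnDiff_apply, quarterTurn_vec,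
      halfTwist_apply, twistFun]
    ext i
    fin_cases i
    · simp [angle_zero, cos_sign, diagramB, AffineMap.lineMap_apply]
    · simp [diagramB, AffineMap.lineMap_apply]
    · simp [angle_zero, sin_sign, diagramB, AffineMap.lineMap_apply]
      ring
  core_left := by
    simp only [Diffeomorph.coe_trans, Function.comp_apply, quarterTurnDiff_apply, quarterTurn_vec,
      halfTwist_apply, twistFun]
    ext i; fin_cases i <;> simp [angle_zero, cos_sign, sin_sign, diagramB]
  core_right := by
    simp only [Diffeomorph.coe_trans, Function.comp_apply, quarterTurnDiff_apply, quarterTurn_vec,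
      halfTwist_apply, twistFun]
    ext i; fin_cases i <;> simp [angle_zero, cos_sign, sin_sign, diagramB]
  untwisted := by
    refine ⟨1, 1, by norm_num, ?_, ?_⟩
    · convert hasDerivAt_twist σ 1 using 1
      · funext x; simp [quarterTurn_vec]
      · ext i; fin_cases i <;> simp [diagramB]
    · convert hasDerivAt_twist σ (-1) using 1
      · funext x; simp [quarterTurn_vec]
      · ext i; fin_cases i <;> simp [diagramB]

/-- The handle of a diagram, after a quarter turn of the diagram. -/
def Handle.turn {P : Diagram} (h : Handle P) : Handle P.turn where
  toDiff := h.toDiff.trans quarterTurnDiff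
  inside := by
    rintro _ ⟨p, hp, rfl⟩
    simpa using h.inside ⟨p, hp, rfl⟩
  sheets p hp :=
    Iff.trans (quarterTurn.injective.mem_set_image (s := P.arcs)) (h.sheets p hp)
  core := by
    rw [Diffeomorph.coe_trans, image_comp, h.core]
    exact image_segment ℝ quarterTurn.toLinearEquiv.toLinearMap.toAffineMap P.a P.b
  core_left := congrArg quarterTurn h.core_left
  core_right := congrArg quarterTurn h.core_right
  untwisted := by
    obtain ⟨ka, kb, hk, ha, hb⟩ := h.untwisted
    refine ⟨ka, kb, hk, ?_, ?_⟩
    · have hd := quarterTurn.toContinuousLinearEquiv.toContinuousLinearMap.hasFDerivAt.comp_hasDerivAt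
        (0 : ℝ) ha
      refine HasDerivAt.congr_deriv (f := fun x : ℝ => quarterTurn (h.toDiff !₂[x, -1, 0])) hd ?_
      change quarterTurn (-(ka • P.da)) = -(ka • quarterTurn P.da)
      rw [map_neg, map_smul]
    · have hd := quarterTurn.toContinuousLinearEquiv.toContinuousLinearMap.hasFDerivAt.comp_hasDerivAt
        (0 : ℝ) hb
      refine HasDerivAt.congr_deriv (f := fun x : ℝ => quarterTurn (h.toDiff !₂[x, 1, 0])) hd ?_
      change quarterTurn (kb • P.db) = kb • quarterTurn P.db
      rw [map_smul]

end CrossingSwitch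

end

open Set
open scoped Manifold ContDiff

noncomputable section

namespace CrossingSwitch

open scoped Topology Filter

/-! Let `t` be the signed chordal distance of the circle coordinate from `1`, and `c = t²`. All the
surfaces are images, under norm-preserving diffeomorphisms of `ℝ³`, of the surface of (a1), which is
the set `z = 0`, `y² = heightA (c, x²)` (`addHandle_A1`). Around the core its equation involves only
`c + x²`; near the waist of the tube it is the hyperboloid `y² = c + x² - 2`.

(a1) and (a2): exchanging `x` and `y` and replacing `c` by `4 - c`, which is what a half turn of the
circle does, preserves the hyperboloid. `heightM` extends it to a surface with this symmetry that is
`y² = x²` far out. Rotating the circle by `π`, with a cutoff in the region where the surface is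
invariant under the circle, carries it to its quarter turn (`isotopic_heightM`). Since `heightA` and
`heightM` agree near the waist and are positive beyond it, a rescaling of `y` relates the two
surfaces (`isotopic_heightA_heightM`). Both are shrunk to a common third surface, because a
shrinking, unlike a stretching, can always be cut off injectively.

(b1) and (b2): applying the half twists `τ±` to the previous isotopy reduces the claim to `τ₊(A)`
and `τ₋(A)`, with `A` the surface of (a1). Rotation by `π` in the `(t, x)`-plane takes the point
`(t, x cos θ, y, x sin θ)` of `τ₊(A)` to `(-t, -x cos θ, y, x sin θ)`, the `τ₋`-image of `(-t, -x,
y, 0)`, which lies in `A` by rotational symmetry. Where `|y| ≥ 1/2` the two twists agree and partial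
rotations preserve the surface, so the rotation may be cut off there (`swirl_halfTwist`). The third
claim is the second one conjugated by the quarter turn. -/

/-- The model of the space `ℝ × (S¹ × ℝ³)` on which isotopies are defined. -/
abbrev J5 : ModelWithCorners ℝ (ℝ × (EuclideanSpace ℝ (Fin 1) × E3))
    (ModelProd ℝ (ModelProd (EuclideanSpace ℝ (Fin 1)) E3)) := 𝓘(ℝ, ℝ).prod I4

/-! ### Chordal distance in the circle and smooth coordinates. -/

/-- Squared chordal distance in the circle from `1`. -/
def chordSq (w : Circle) : ℝ := ‖(w : ℂ) - 1‖ ^ 2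

theorem chordSq_nonneg (w : Circle) : 0 ≤ chordSq w := sq_nonneg _

theorem chordSq_eq (w : Circle) : chordSq w = 2 - 2 * (w : ℂ).re := by
  have h : Complex.normSq (w : ℂ) = 1 := Circle.normSq_coe w
  rw [chordSq, ← Complex.normSq_eq_norm_sq, Complex.normSq_sub, h]
  simp
  ring

theorem chordSq_le (w : Circle) : chordSq w ≤ 4 := by
  have h := (abs_le.1 (Complex.abs_re_le_norm (w : ℂ))).1
  rw [Circle.norm_coe] at h
  rw [chordSq_eq]
  linarith

theorem norm_sq_eq (p : E3) : ‖p‖ ^ 2 = p 0 ^ 2 + p 1 ^ 2 + p 2 ^ 2 := by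
  rw [EuclideanSpace.norm_sq_eq]
  simp [Fin.sum_univ_three]

theorem contMDiff_coe_circle : ContMDiff (𝓡 1) 𝓘(ℝ, ℂ) ∞ (fun w : Circle => (w : ℂ)) := by
  have := finrank_real_complex_fact'
  exact contMDiff_coe_sphere (E := ℂ) (n := 1)

theorem contMDiff_chordSq : ContMDiff (𝓡 1) 𝓘(ℝ, ℝ) ∞ chordSq := by
  have h : ContDiff ℝ ∞ (fun w : ℂ => ‖w - 1‖ ^ 2) :=
    (contDiff_norm_sq ℝ).comp (contDiff_id.sub contDiff_const)
  exact h.contMDiff.comp contMDiff_coe_circle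

section Coordinates

variable {q : ℝ × X4}

theorem smooth_circle : ContMDiff J5 (𝓡 1) ∞ (fun q : ℝ × X4 => q.2.1) :=
  contMDiff_fst.comp contMDiff_snd

theorem smooth_space : ContMDiff J5 𝓘(ℝ, E3) ∞ (fun q : ℝ × X4 => q.2.2) :=
  contMDiff_snd.comp contMDiff_snd

theorem smooth_coord (i : Fin 3) : ContMDiff J5 𝓘(ℝ, ℝ) ∞ (fun q : ℝ × X4 => q.2.2 i) := by
  have h : ContDiff ℝ ∞ (fun p : E3 => p i) := contDiff_euclidean.1 contDiff_id i
  exact h.contMDiff.comp smooth_space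

theorem smooth_chordSq : ContMDiff J5 𝓘(ℝ, ℝ) ∞ (fun q : ℝ × X4 => chordSq q.2.1) :=
  contMDiff_chordSq.comp smooth_circle

theorem smooth_normSq : ContMDiff J5 𝓘(ℝ, ℝ) ∞ (fun q : ℝ × X4 => ‖q.2.2‖ ^ 2) := by
  have h : ContDiff ℝ ∞ (fun p : E3 => ‖p‖ ^ 2) := contDiff_norm_sq ℝ
  exact h.contMDiff.comp smooth_space

theorem contMDiffAt_vec {f0 f1 f2 : ℝ × X4 → ℝ} (h0 : ContMDiffAt J5 𝓘(ℝ, ℝ) ∞ f0 q)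
    (h1 : ContMDiffAt J5 𝓘(ℝ, ℝ) ∞ f1 q) (h2 : ContMDiffAt J5 𝓘(ℝ, ℝ) ∞ f2 q) :
    ContMDiffAt J5 𝓘(ℝ, E3) ∞ (fun q => !₂[f0 q, f1 q, f2 q]) q := by
  have h : ContDiff ℝ ∞ (fun a : ℝ × ℝ × ℝ => (!₂[a.1, a.2.1, a.2.2] : E3)) := by
    rw [contDiff_euclidean]
    intro i
    fin_cases i
    · exact contDiff_fst
    · exact contDiff_fst.comp contDiff_snd
    · exact contDiff_snd.comp contDiff_snd
  exact h.contMDiff.contMDiffAt.comp q (h0.prodMk_space (h1.prodMk_space h2))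

end Coordinates

/-! ### Building isotopies, and isotopy as an equivalence relation -/

theorem isotopic_of_inverse_families {S S' : Set X4} (Φ Ψ : ℝ → X4 → X4)
    (hΦ : ContMDiff J5 I4 ∞ (fun q : ℝ × X4 => Φ q.1 q.2))
    (hΨ : ContMDiff J5 I4 ∞ (fun q : ℝ × X4 => Ψ q.1 q.2))
    (left : ∀ s q, Ψ s (Φ s q) = q) (right : ∀ s q, Φ s (Ψ s q) = q)
    (zero : ∀ q, Φ 0 q = q) (image : ∀ q, Φ 1 q ∈ S' ↔ q ∈ S)
    (supp : ∃ r < (10 : ℝ), ∀ (s : ℝ) (q : X4), r ≤ ‖q.2‖ → Φ s q = q) :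
    IsotopicRelBoundary S S' := by
  have slice : ∀ s : ℝ, ContMDiff I4 J5 ∞ (fun q : X4 => (s, q)) := fun s =>
    contMDiff_const.prodMk contMDiff_id
  refine ⟨fun s => ⟨⟨Φ s, Ψ s, left s, right s⟩, hΦ.comp (slice s), hΨ.comp (slice s)⟩,
    hΦ, zero, ?_, supp⟩
  ext q
  constructor
  · rintro ⟨a, ha, rfl⟩
    exact (image a).2 ha
  · intro hq
    refine ⟨Ψ 1 q, (image _).1 ?_, right 1 q⟩
    rwa [right 1 q]

/-- The families are composed at each time, which is smooth in `s` without any reparametrisation at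
the junction. -/
theorem IsotopicRelBoundary.trans {S S' S'' : Set X4} (h : IsotopicRelBoundary S S')
    (h' : IsotopicRelBoundary S' S'') : IsotopicRelBoundary S S'' := by
  obtain ⟨Φ, hΦ, h0, h1, r, hr, hs⟩ := h
  obtain ⟨Φ', hΦ', h0', h1', r', hr', hs'⟩ := h'
  refine ⟨fun s => (Φ s).trans (Φ' s), ?_, ?_, ?_, max r r', max_lt hr hr', ?_⟩
  · exact hΦ'.comp (contMDiff_fst.prodMk hΦ)
  · intro q
    simp [h0, h0']
  · rw [Diffeomorph.coe_trans, image_comp, h1, h1']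
  · intro s q hq
    simp [hs s q (le_trans (le_max_left _ _) hq), hs' s q (le_trans (le_max_right _ _) hq)]

theorem IsotopicRelBoundary.symm {S S' : Set X4} (h : IsotopicRelBoundary S S') :
    IsotopicRelBoundary S' S := by
  obtain ⟨Φ, hΦ, h0, h1, r, hr, hs⟩ := h
  -- Only the fixed diffeomorphism `Φ 1` is inverted, so no smoothness of the inverses in `s` is
  -- needed.
  refine ⟨fun s => (Φ 1).symm.trans (Φ (1 - s)), ?_, ?_, ?_, r, hr, ?_⟩
  · have hsub : ContDiff ℝ ∞ (fun s : ℝ => 1 - s) := contDiff_const.sub contDiff_id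
    exact hΦ.comp ((hsub.contMDiff.comp contMDiff_fst).prodMk
      ((Φ 1).symm.contMDiff.comp contMDiff_snd))
  · intro q
    simp
  · rw [← h1, ← image_comp]
    simp [Function.comp_def, h0]
  · intro s q hq
    have : (Φ 1).symm q = q := by
      conv_lhs => rw [← hs 1 q hq]
      simp
    simp [this, hs _ q hq]

/-- The product of the identity of the circle with a diffeomorphism of `ℝ³`. -/
def spin (ψ : E3 ≃ₘ^∞⟮𝓘(ℝ, E3), 𝓘(ℝ, E3)⟯ E3) : X4 ≃ₘ^∞⟮I4, I4⟯ X4 :=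
  (Diffeomorph.refl (𝓡 1) Circle ∞).prodCongr ψ

@[simp] theorem spin_apply (ψ : E3 ≃ₘ^∞⟮𝓘(ℝ, E3), 𝓘(ℝ, E3)⟯ E3) (q : X4) :
    spin ψ q = (q.1, ψ q.2) := rfl

theorem norm_spin_symm_snd {ψ : E3 ≃ₘ^∞⟮𝓘(ℝ, E3), 𝓘(ℝ, E3)⟯ E3} (hψ : ∀ p, ‖ψ p‖ = ‖p‖) (q : X4) :
    ‖((spin ψ).symm q).2‖ = ‖q.2‖ := by
  obtain ⟨a, rfl⟩ : ∃ a, spin ψ a = q := (spin ψ).surjective q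
  rw [Diffeomorph.symm_apply_apply, spin_apply, hψ]

/-- Conjugation by `spin ψ`; preservation of the norm keeps the support within the same radius. -/
theorem IsotopicRelBoundary.spin_image {S S' : Set X4} (h : IsotopicRelBoundary S S')
    (ψ : E3 ≃ₘ^∞⟮𝓘(ℝ, E3), 𝓘(ℝ, E3)⟯ E3) (hψ : ∀ p, ‖ψ p‖ = ‖p‖) :
    IsotopicRelBoundary (spin ψ '' S) (spin ψ '' S') := by
  obtain ⟨Φ, hΦ, h0, h1, r, hr, hs⟩ := h
  refine ⟨fun s => ((spin ψ).symm.trans (Φ s)).trans (spin ψ), ?_, ?_, ?_, r, hr, ?_⟩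
  · exact (spin ψ).contMDiff.comp (hΦ.comp (contMDiff_fst.prodMk
      ((spin ψ).symm.contMDiff.comp contMDiff_snd)))
  · intro q
    simp [h0, -spin_apply]
  · rw [← h1, ← image_comp, ← image_comp]
    congr 1
    ext1 q
    simp [-spin_apply]
  · intro s q hq
    have hn := hs s _ (hq.trans (norm_spin_symm_snd hψ q).ge)
    simp only [Diffeomorph.coe_trans, Function.comp_apply, hn, Diffeomorph.apply_symm_apply]

/-! ### Handles under diffeomorphisms of `ℝ³` -/

theorem addHandle_spin {P P' : Diagram} (h : Handle P) (h' : Handle P')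
    (ψ : E3 ≃ₘ^∞⟮𝓘(ℝ, E3), 𝓘(ℝ, E3)⟯ E3) (harcs : P'.arcs = ψ '' P.arcs)
    (hdiff : ∀ p, h'.toDiff p = ψ (h.toDiff p)) : addHandle h' = spin ψ '' addHandle h := by
  have hplace : h'.place = spin ψ ∘ h.place := by
    funext q
    simp [Handle.place, hdiff]
  have hann : P'.annuli = spin ψ '' P.annuli := by
    ext ⟨w, p⟩
    simp only [Diagram.annuli, mem_ofPred_eq, harcs]
    constructor
    · rintro ⟨a, ha, rfl⟩
      exact ⟨(w, a), ha, rfl⟩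
    · rintro ⟨⟨w', a⟩, ha, he⟩
      exact ⟨a, ha, congrArg Prod.snd he⟩
  rw [addHandle, addHandle, hplace, hann, image_union, image_comp, image_comp]
  congr 1
  exact (image_sdiff (spin ψ).injective _ _).symm

theorem addHandle_A2 : addHandle handleA2 = spin quarterTurnDiff '' addHandle handleA1 := by
  refine addHandle_spin _ _ _ ?_ fun p => rfl
  ext p
  constructor
  · intro hp
    refine ⟨quarterTurn.symm p, ?_, quarterTurn.apply_symm_apply p⟩
    rwa [← quarterTurn_diagramA1, LinearIsometryEquiv.apply_symm_apply]
  · rintro ⟨a, ha, rfl⟩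
    exact (quarterTurn_diagramA1 a).2 ha

theorem addHandle_B (σ : ℤˣ) :
    addHandle (handleB σ) = spin (halfTwist σ) '' addHandle handleA2 :=
  addHandle_spin _ _ _ rfl fun _ => rfl

theorem addHandle_turn {P : Diagram} (h : Handle P) :
    addHandle h.turn = spin quarterTurnDiff '' addHandle h :=
  addHandle_spin _ _ _ rfl fun _ => rfl

/-! ### The profile functions -/

theorem profile_of_le {r : ℝ} (h : r ≤ 9 / 4) : profile r = r - 2 := by
  rw [profile, Real.smoothTransition.zero_of_nonpos (by linarith)]
  ring

theorem profile_of_ge {r : ℝ} (h : 3 ≤ r) : profile r = 1 := by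
  rw [profile, Real.smoothTransition.one_of_one_le (by linarith)]
  ring

theorem profile_le_one (r : ℝ) : profile r ≤ 1 := by
  rcases le_total 3 r with h | h
  · exact (profile_of_ge h).le
  · have h1 := Real.smoothTransition.le_one ((r - 9 / 4) / (3 / 4))
    rw [profile]
    nlinarith

theorem profile_monotone : Monotone profile := by
  intro r r' h
  rcases le_total 3 r' with h' | h'
  · rw [profile_of_ge h']
    exact profile_le_one r
  · have h1 : Real.smoothTransition ((r - 9 / 4) / (3 / 4)) ≤
        Real.smoothTransition ((r' - 9 / 4) / (3 / 4)) :=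
      Real.smoothTransition.monotone (by linarith)
    have h2 := Real.smoothTransition.le_one ((r - 9 / 4) / (3 / 4))
    rw [profile, profile]
    nlinarith [mul_nonneg (sub_nonneg.2 h1) (sub_nonneg.2 h'),
      mul_nonneg (sub_nonneg.2 h2) (sub_nonneg.2 h)]

theorem profile_contDiff : ContDiff ℝ ∞ profile :=
  (contDiff_id.sub contDiff_const).add
    ((Real.smoothTransition.contDiff.comp ((contDiff_id.sub contDiff_const).div_const _)).mul
      (contDiff_const.sub contDiff_id))

theorem profile_pos {r : ℝ} (h : 2 < r) : 0 < profile r := by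
  rcases le_total r (9 / 4) with h' | h'
  · rw [profile_of_le h']
    linarith
  · have := profile_monotone h'
    rw [profile_of_le le_rfl] at this
    linarith

theorem arcShape_of_le {s : ℝ} (hs : s ≤ 4) : arcShape s = 1 := by
  rw [arcShape, Real.smoothTransition.zero_of_nonpos (by linarith)]
  ring

theorem arcShape_of_ge {s : ℝ} (hs : 9 ≤ s) : arcShape s = s := by
  rw [arcShape, Real.smoothTransition.one_of_one_le (by linarith)]
  ring

theorem one_le_arcShape (s : ℝ) : 1 ≤ arcShape s := by
  rcases le_total s 4 with h | h
  · exact (arcShape_of_le h).ge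
  · have := mul_nonneg (by linarith : (0 : ℝ) ≤ s - 1)
      (Real.smoothTransition.nonneg ((s - 4) / 5))
    rw [arcShape]
    linarith

theorem arcShape_le {s : ℝ} (h : 1 ≤ s) : arcShape s ≤ s := by
  have := mul_le_mul_of_nonneg_left (Real.smoothTransition.le_one ((s - 4) / 5)) (sub_nonneg.2 h)
  rw [arcShape]
  linarith

theorem arcShape_contDiff : ContDiff ℝ ∞ arcShape :=
  contDiff_const.add ((contDiff_id.sub contDiff_const).mul
    (Real.smoothTransition.contDiff.comp ((contDiff_id.sub contDiff_const).div_const _)))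

/-- A monotone smooth function, `r` for `r ≤ 3` and constantly `12` for `r ≥ 12`. -/
def ramp (r : ℝ) : ℝ := 12 * profile (r / 12 + 2)

theorem ramp_of_le {r : ℝ} (h : r ≤ 3) : ramp r = r := by
  rw [ramp, profile_of_le (by linarith)]
  ring

theorem ramp_of_ge {r : ℝ} (h : 12 ≤ r) : ramp r = 12 := by
  rw [ramp, profile_of_ge (by linarith)]
  ring

theorem ramp_le (r : ℝ) : ramp r ≤ 12 := by
  have := profile_le_one (r / 12 + 2)
  rw [ramp]
  linarith

theorem ramp_monotone : Monotone ramp := fun r r' h =>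
  mul_le_mul_of_nonneg_left (profile_monotone (by linarith)) (by norm_num)

theorem ramp_contDiff : ContDiff ℝ ∞ ramp :=
  contDiff_const.mul (profile_contDiff.comp ((contDiff_id.div_const _).add contDiff_const))

/-! ### Smooth dependence of the inverse of a function on a parameter -/

/-- The map `(a, y) ↦ (a, f (a, y))` has a triangular derivative with diagonal entries `1` and `d ≠
0`. By the inverse function theorem it has a smooth local inverse, and `hg` identifies `g` with its
second component. -/
theorem contDiffAt_fiberwise_inverse {f g : ℝ × ℝ → ℝ} {a y d : ℝ}
    (hf : ContDiffAt ℝ ∞ f (a, y)) (hd : HasDerivAt (fun y => f (a, y)) d y) (hd0 : d ≠ 0)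
    (hg : ∀ᶠ p in 𝓝 (a, y), g (p.1, f p) = p.2) : ContDiffAt ℝ ∞ g (a, f (a, y)) := by
  have hn : (∞ : WithTop ℕ∞) ≠ 0 := by simp
  have hfd : HasFDerivAt f (fderiv ℝ f (a, y)) (a, y) :=
    (hf.differentiableAt hn).hasFDerivAt
  have hdir : fderiv ℝ f (a, y) (0, 1) = d := by
    have h1 : HasDerivAt (fun y : ℝ => (a, y)) ((0 : ℝ), (1 : ℝ)) y :=
      (hasDerivAt_const y a).prodMk (hasDerivAt_id y)
    exact (hfd.comp_hasDerivAt y h1).unique hd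
  let D : ℝ × ℝ →L[ℝ] ℝ × ℝ := (ContinuousLinearMap.fst ℝ ℝ ℝ).prod (fderiv ℝ f (a, y))
  have hinj : Function.Injective (D : ℝ × ℝ →ₗ[ℝ] ℝ × ℝ) := by
    rw [injective_iff_map_eq_zero]
    rintro ⟨b, z⟩ h
    have hb : b = 0 := congrArg Prod.fst h
    have hz : fderiv ℝ f (a, y) (b, z) = 0 := congrArg Prod.snd h
    subst hb
    have : ((0 : ℝ), z) = z • ((0 : ℝ), (1 : ℝ)) := by simp
    rw [this, map_smul, hdir, smul_eq_mul, mul_eq_zero, or_iff_left hd0] at hz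
    rw [hz]
    rfl
  let e : (ℝ × ℝ) ≃L[ℝ] (ℝ × ℝ) :=
    (LinearEquiv.ofInjectiveEndo (D : ℝ × ℝ →ₗ[ℝ] ℝ × ℝ) hinj).toContinuousLinearEquiv
  have he : (e : ℝ × ℝ →L[ℝ] ℝ × ℝ) = D := by
    ext <;> rfl
  have hΓ : ContDiffAt ℝ ∞ (fun p : ℝ × ℝ => (p.1, f p)) (a, y) := contDiffAt_fst.prodMk hf
  have hΓ' : HasFDerivAt (fun p : ℝ × ℝ => (p.1, f p)) (e : ℝ × ℝ →L[ℝ] ℝ × ℝ) (a, y) := by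
    rw [he]
    exact hasFDerivAt_fst.prodMk hfd
  have hinv := (hΓ.hasStrictFDerivAt' hΓ' hn).localInverse_unique (g := fun p => (p.1, g p))
    (hg.mono fun p hp => Prod.ext rfl hp)
  exact contDiffAt_snd.comp _ ((hΓ.to_localInverse hΓ' hn).congr_of_eventuallyEq hinv)

/-! ### Surfaces over the `(θ, x)`-cylinder -/

/-- The surface `z = 0`, `y² = h (c, x²)` in `S¹ × D³`, where `c` is the squared distance of the
circle coordinate from `1`. -/
def graphSurface (h : ℝ × ℝ → ℝ) : Set X4 :=
  {q | ‖q.2‖ ≤ 10 ∧ q.2 2 = 0 ∧ (q.2 1) ^ 2 = h (chordSq q.1, (q.2 0) ^ 2)}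

theorem mem_graphSurface {h : ℝ × ℝ → ℝ} {q : X4} : q ∈ graphSurface h ↔
    ‖q.2‖ ≤ 10 ∧ q.2 2 = 0 ∧ (q.2 1) ^ 2 = h (chordSq q.1, (q.2 0) ^ 2) := Iff.rfl

/-- The height function of the surface represented by (a1). -/
def heightA (p : ℝ × ℝ) : ℝ := profile (p.1 + p.2) + arcShape p.2 - 1

theorem heightA_contDiff : ContDiff ℝ ∞ heightA :=
  ((profile_contDiff.comp (contDiff_fst.add contDiff_snd)).add
    (arcShape_contDiff.comp contDiff_snd)).sub contDiff_const

/-- Where `rho ≤ 3` one has `arcShape = 1`; the sheets lie in the attaching region and are removed,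
so only the tube remains. Where `rho > 3` one has `profile = 1`, and only the annuli remain. The sum
in `heightA` covers both cases. -/
theorem addHandle_A1 : addHandle handleA1 = graphSurface heightA := by
  have hplace : handleA1.place = id := rfl
  ext q
  rw [addHandle, hplace, image_id, image_id, mem_graphSurface]
  have hrho : rho q = chordSq q.1 + (q.2 0) ^ 2 := rfl
  have hc := chordSq_nonneg q.1
  have hc' := chordSq_le q.1
  have hx := sq_nonneg (q.2 0)
  simp only [mem_union, mem_sdiff, Diagram.annuli, mem_ofPred_eq, diagramA1, disc,
    mem_closedBall_zero_iff, solidHandle, tube, heightA]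
  rw [← hrho]
  rcases le_or_gt (rho q) 3 with hr | hr
  · have ha : arcShape (q.2 0 ^ 2) = 1 := arcShape_of_le (by linarith)
    have hp := profile_le_one (rho q)
    rw [ha]
    constructor
    · rintro (⟨⟨h1, h2, h3⟩, h4⟩ | ⟨h2, -, h3⟩)
      · exact absurd ⟨h2, hr, le_of_eq h3, by linarith⟩ h4
      · refine ⟨abs_le_of_sq_le_sq' ?_ (by norm_num) |>.2, h2, by linarith⟩
        rw [norm_sq_eq, h2, h3]
        linarith
    · rintro ⟨-, h2, h3⟩
      exact Or.inr ⟨h2, hr, by linarith⟩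
  · rw [profile_of_ge hr.le]
    constructor
    · rintro (⟨⟨h1, h2, h3⟩, -⟩ | ⟨-, h, -⟩)
      · exact ⟨h1, h2, by linarith⟩
      · linarith
    · rintro ⟨h1, h2, h3⟩
      exact Or.inl ⟨⟨h1, h2, by linarith⟩, fun h => by linarith [h.2.1]⟩

/-! ### Rotation about the core of the handle -/

/-- The signed chordal distance in the circle from `1`. -/
def halfChord (w : Circle) : ℝ := 2 * Real.sin ((w : ℂ).arg / 2)

/-- The point of the circle with a given signed chordal distance from `1`. -/
def ofHalfChord (t : ℝ) : Circle := Circle.exp (2 * Real.arcsin (t / 2))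

theorem halfChord_sq (w : Circle) : halfChord w ^ 2 = chordSq w := by
  have h : Real.cos (w : ℂ).arg = (w : ℂ).re := by
    rw [Complex.cos_arg (Circle.coe_ne_zero w), Circle.norm_coe, div_one]
  have h2 := Real.cos_sq' ((w : ℂ).arg / 2)
  have h3 := Real.cos_two_mul ((w : ℂ).arg / 2)
  rw [mul_div_cancel₀ _ (two_ne_zero)] at h3
  rw [chordSq_eq, halfChord, ← h, h3, h2]
  ring

theorem ofHalfChord_halfChord (w : Circle) : ofHalfChord (halfChord w) = w := by
  have h1 := Complex.neg_pi_lt_arg (w : ℂ)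
  have h2 := Complex.arg_le_pi (w : ℂ)
  rw [ofHalfChord, halfChord, mul_div_cancel_left₀ _ two_ne_zero,
    Real.arcsin_sin (by linarith) (by linarith), mul_div_cancel₀ _ two_ne_zero, Circle.exp_arg]

theorem halfChord_ofHalfChord {t : ℝ} (ht : t ^ 2 < 4) : halfChord (ofHalfChord t) = t := by
  have h1 : -1 < t / 2 := by nlinarith
  have h2 : t / 2 < 1 := by nlinarith
  have h3 := Real.neg_pi_div_two_lt_arcsin.2 h1
  have h4 := Real.arcsin_le_pi_div_two (t / 2)
  rw [halfChord, ofHalfChord, Circle.arg_exp (by linarith) (by linarith),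
    mul_div_cancel_left₀ _ two_ne_zero, Real.sin_arcsin h1.le h2.le]
  ring

theorem contMDiffAt_halfChord {w : Circle} (hw : chordSq w < 4) :
    ContMDiffAt (𝓡 1) 𝓘(ℝ, ℝ) ∞ halfChord w := by
  -- The only point of the circle off the slit plane is `-1`, at squared chordal distance `4`.
  have hs : (w : ℂ) ∈ Complex.slitPlane := by
    rw [Complex.mem_slitPlane_iff]
    by_contra! h
    have h1 : Complex.normSq (w : ℂ) = 1 := Circle.normSq_coe w
    rw [Complex.normSq_apply, h.2] at h1
    rw [chordSq_eq] at hw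
    nlinarith [h.1]
  have h : ContDiffAt ℝ ∞ (fun v : ℂ => 2 * Real.sin ((Complex.log v).im / 2)) (w : ℂ) := by
    have hlog : ContDiffAt ℝ ∞ Complex.log (w : ℂ) := (Complex.contDiffAt_log hs).restrict_scalars ℝ
    have him : ContDiffAt ℝ ∞ (fun v : ℂ => (Complex.log v).im) (w : ℂ) :=
      Complex.imCLM.contDiff.contDiffAt.comp (w : ℂ) hlog
    exact contDiffAt_const.mul (Real.contDiff_sin.contDiffAt.comp (w : ℂ) (him.div_const 2))
  have hw' : ContMDiffAt (𝓡 1) 𝓘(ℝ, ℝ) ∞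
      (fun v : Circle => 2 * Real.sin ((Complex.log (v : ℂ)).im / 2)) w :=
    h.contMDiffAt.comp w contMDiff_coe_circle.contMDiffAt
  refine hw'.congr_of_eventuallyEq (Filter.Eventually.of_forall fun v => ?_)
  simp [halfChord, Complex.log_im]

/-- Squared distance from the point `(1, 0)`. -/
def reach (q : X4) : ℝ := chordSq q.1 + ‖q.2‖ ^ 2

theorem reach_eq (q : X4) :
    reach q = halfChord q.1 ^ 2 + ((q.2 0) ^ 2 + (q.2 1) ^ 2 + (q.2 2) ^ 2) := by
  rw [reach, norm_sq_eq, halfChord_sq]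

/-- Rotation of the plane of the circle coordinate and the first coordinate of `ℝ³`. -/
def turnCore (φ : ℝ) (q : X4) : X4 :=
  (ofHalfChord (Real.cos φ * halfChord q.1 - Real.sin φ * q.2 0),
    !₂[Real.sin φ * halfChord q.1 + Real.cos φ * q.2 0, q.2 1, q.2 2])

theorem rotation_sq (φ a b : ℝ) : (Real.cos φ * a - Real.sin φ * b) ^ 2 +
    (Real.sin φ * a + Real.cos φ * b) ^ 2 = a ^ 2 + b ^ 2 := by
  linear_combination (a ^ 2 + b ^ 2) * Real.sin_sq_add_cos_sq φ

theorem rotation_lt {q : X4} (hq : reach q < 4) (φ : ℝ) :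
    (Real.cos φ * halfChord q.1 - Real.sin φ * q.2 0) ^ 2 < 4 := by
  rw [reach_eq] at hq
  have := rotation_sq φ (halfChord q.1) (q.2 0)
  nlinarith [sq_nonneg (Real.sin φ * halfChord q.1 + Real.cos φ * q.2 0), sq_nonneg (q.2 1),
    sq_nonneg (q.2 2)]

theorem reach_turnCore {q : X4} (hq : reach q < 4) (φ : ℝ) : reach (turnCore φ q) = reach q := by
  rw [reach_eq, reach_eq]
  simp only [turnCore, halfChord_ofHalfChord (rotation_lt hq φ)]
  simp
  linear_combination rotation_sq φ (halfChord q.1) (q.2 0)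

theorem turnCore_zero (q : X4) : turnCore 0 q = q := by
  refine Prod.ext ?_ ?_
  · simp [turnCore, ofHalfChord_halfChord]
  · ext i; fin_cases i <;> simp [turnCore]

theorem turnCore_neg {q : X4} (hq : reach q < 4) (φ : ℝ) : turnCore (-φ) (turnCore φ q) = q := by
  have h := Real.sin_sq_add_cos_sq φ
  have h1 := halfChord_ofHalfChord (rotation_lt hq φ)
  refine Prod.ext ?_ ?_
  · conv_rhs => rw [← ofHalfChord_halfChord q.1]
    simp only [turnCore, h1]
    congr 1
    simp
    linear_combination (halfChord q.1) * h
  · simp only [turnCore, h1]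
    ext i
    fin_cases i
    · simp
      linear_combination (q.2 0) * h
    · simp
    · simp

/-- The angle of rotation. -/
def coreAngle (s : ℝ) (q : X4) : ℝ := Real.pi * s * Real.smoothTransition (7 / 2 - reach q)

/-- Rotation about the core of the handle, with an angle that decreases to `0` away from it. -/
def swirl (s : ℝ) (q : X4) : X4 := if reach q < 4 then turnCore (coreAngle s q) q else q

theorem swirl_of_lt {q : X4} (hq : reach q < 4) (s : ℝ) :
    swirl s q = turnCore (coreAngle s q) q := if_pos hq

theorem swirl_of_ge {q : X4} (hq : 7 / 2 ≤ reach q) (s : ℝ) : swirl s q = q := by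
  by_cases h : reach q < 4
  · rw [swirl_of_lt h, coreAngle, Real.smoothTransition.zero_of_nonpos (by linarith), mul_zero,
      turnCore_zero]
  · exact if_neg h

theorem swirl_neg (s : ℝ) (q : X4) : swirl (-s) (swirl s q) = q := by
  by_cases h : reach q < 4
  · have h1 := reach_turnCore h (coreAngle s q)
    -- The angle depends on the point only through `reach`, which the rotation preserves.
    have h2 : coreAngle (-s) (turnCore (coreAngle s q) q) = -coreAngle s q := by
      rw [coreAngle, h1, coreAngle]
      ring
    rw [swirl_of_lt h, swirl_of_lt (h1.trans_lt h), h2, turnCore_neg h]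
  · have : 7 / 2 ≤ reach q := by linarith
    rw [swirl_of_ge this, swirl_of_ge this]

theorem swirl_snd_one (s : ℝ) (q : X4) : (swirl s q).2 1 = q.2 1 := by
  rw [swirl]
  split_ifs <;> simp [turnCore]

theorem smooth_reach : ContMDiff J5 𝓘(ℝ, ℝ) ∞ (fun q : ℝ × X4 => reach q.2) :=
  smooth_chordSq.add smooth_normSq

/-- The open sets `reach < 4`, where the rotation formula is smooth, and `reach > 7/2`, where the
map is the identity, cover everything. -/
theorem smooth_swirl : ContMDiff J5 I4 ∞ (fun q : ℝ × X4 => swirl q.1 q.2) := by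
  have hcont : Continuous (fun q : ℝ × X4 => reach q.2) := smooth_reach.continuous
  intro q
  by_cases h : reach q.2 < 4
  · have hev : (fun q : ℝ × X4 => swirl q.1 q.2) =ᶠ[𝓝 q]
        fun q => turnCore (coreAngle q.1 q.2) q.2 :=
      (hcont.continuousAt.eventually_lt_const h).mono fun p hp => swirl_of_lt hp _
    refine ContMDiffAt.congr_of_eventuallyEq ?_ hev
    have hφ : ContMDiffAt J5 𝓘(ℝ, ℝ) ∞ (fun q : ℝ × X4 => coreAngle q.1 q.2) q := by
      have hS : ContDiff ℝ ∞ (fun a : ℝ × ℝ => Real.pi * a.1 * Real.smoothTransition (7 / 2 - a.2)) :=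
        (contDiff_const.mul contDiff_fst).mul
          (Real.smoothTransition.contDiff.comp (contDiff_const.sub contDiff_snd))
      exact hS.contMDiff.contMDiffAt.comp q
        ((contMDiff_fst.prodMk_space smooth_reach).contMDiffAt)
    have ht : ContMDiffAt J5 𝓘(ℝ, ℝ) ∞ (fun q : ℝ × X4 => halfChord q.2.1) q := by
      refine ContMDiffAt.comp (g := halfChord) q (contMDiffAt_halfChord ?_) smooth_circle.contMDiffAt
      have : reach q.2 = chordSq q.2.1 + ‖q.2.2‖ ^ 2 := rfl
      linarith [sq_nonneg ‖q.2.2‖]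
    have hx := (smooth_coord 0).contMDiffAt (x := q)
    have hcos : ContMDiffAt J5 𝓘(ℝ, ℝ) ∞ (fun q : ℝ × X4 => Real.cos (coreAngle q.1 q.2)) q :=
      Real.contDiff_cos.contMDiff.contMDiffAt.comp q hφ
    have hsin : ContMDiffAt J5 𝓘(ℝ, ℝ) ∞ (fun q : ℝ × X4 => Real.sin (coreAngle q.1 q.2)) q :=
      Real.contDiff_sin.contMDiff.contMDiffAt.comp q hφ
    refine ContMDiffAt.prodMk ?_ (contMDiffAt_vec ((hsin.mul ht).add (hcos.mul hx))
      (smooth_coord 1).contMDiffAt (smooth_coord 2).contMDiffAt)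
    have hlt := rotation_lt h (coreAngle q.1 q.2)
    have harc : ContDiffAt ℝ ∞ (fun t : ℝ => 2 * Real.arcsin (t / 2))
        (Real.cos (coreAngle q.1 q.2) * halfChord q.2.1 -
          Real.sin (coreAngle q.1 q.2) * q.2.2 0) := by
      refine contDiffAt_const.mul (ContDiffAt.comp (g := Real.arcsin) _
        (Real.contDiffAt_arcsin ?_ ?_) (contDiffAt_id.div_const 2))
      · nlinarith
      · nlinarith
    have harg := harc.contMDiffAt.comp (g := fun t : ℝ => 2 * Real.arcsin (t / 2)) q
      ((hcos.mul ht).sub (hsin.mul hx))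
    exact contMDiff_circleExp.contMDiffAt.comp q harg
  · have hev : (fun q : ℝ × X4 => swirl q.1 q.2) =ᶠ[𝓝 q] fun q => q.2 :=
      (hcont.continuousAt.eventually_const_lt (by linarith : 7 / 2 < reach q.2)).mono
        fun p hp => swirl_of_ge (le_of_lt hp) _
    exact contMDiffAt_snd.congr_of_eventuallyEq hev

/-! ### The surface of (a1) is invariant under rotation about the core -/

/-- Here `x² < 4`, so `arcShape` drops out and the equation is visibly invariant under rotation of
the `(t, x)`-plane. -/
theorem mem_heightA_of_reach_lt {q : X4} (hq : reach q < 4) : q ∈ graphSurface heightA ↔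
    q.2 2 = 0 ∧ (q.2 1) ^ 2 = profile (halfChord q.1 ^ 2 + (q.2 0) ^ 2) := by
  have hn : reach q = chordSq q.1 + ‖q.2‖ ^ 2 := rfl
  have hc := chordSq_nonneg q.1
  have h0 : (q.2 0) ^ 2 < 4 := by
    rw [norm_sq_eq] at hn
    linarith [sq_nonneg (q.2 1), sq_nonneg (q.2 2)]
  have h1 : ‖q.2‖ ≤ 10 := by nlinarith
  rw [mem_graphSurface, heightA, arcShape_of_lt h0, halfChord_sq]
  simp only [h1, true_and, add_sub_cancel_right]

theorem swirl_mem {q : X4} (hq : q ∈ graphSurface heightA) (s : ℝ) :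
    swirl s q ∈ graphSurface heightA := by
  by_cases h : reach q < 4
  · rw [swirl_of_lt h, mem_heightA_of_reach_lt ((reach_turnCore h _).trans_lt h)]
    obtain ⟨h2, h1⟩ := (mem_heightA_of_reach_lt h).1 hq
    refine ⟨h2, h1.trans ?_⟩
    simp only [turnCore, halfChord_ofHalfChord (rotation_lt h _)]
    exact congrArg profile (rotation_sq _ _ _).symm
  · rwa [swirl_of_ge (by linarith)]

theorem lt_profile {r : ℝ} (h : 9 / 4 < r) : 1 / 4 < profile r := by
  rcases le_total r 3 with h' | h'
  · have := mul_nonneg (Real.smoothTransition.nonneg ((r - 9 / 4) / (3 / 4))) (sub_nonneg.2 h')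
    rw [profile]
    linarith
  · rw [profile_of_ge h']
    norm_num

/-- The part of the surface on which the twist happens lies where the rotation has its full angle:
`profile` exceeds `1/4` beyond `9/4`, so `reach` is at most `9/4 + 1/4`. -/
theorem reach_le_of_mem {q : X4} (hq : q ∈ graphSurface heightA) (hy : (q.2 1) ^ 2 ≤ 1 / 4) :
    reach q ≤ 5 / 2 := by
  obtain ⟨-, h2, h3⟩ := hq
  have ha := one_le_arcShape ((q.2 0) ^ 2)
  have hc := chordSq_nonneg q.1
  have hr : chordSq q.1 + (q.2 0) ^ 2 ≤ 9 / 4 := by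
    by_contra! h
    have := lt_profile h
    simp only [heightA] at h3
    linarith
  rw [reach, norm_sq_eq, h2]
  linarith

theorem flip_mem {q : X4} (hq : q ∈ graphSurface heightA) :
    (q.1, !₂[-q.2 0, q.2 1, -q.2 2]) ∈ graphSurface heightA := by
  obtain ⟨h1, h2, h3⟩ := hq
  refine ⟨?_, ?_, ?_⟩
  · refine le_trans (le_of_eq ?_) h1
    rw [← sq_eq_sq₀ (norm_nonneg _) (norm_nonneg _), norm_sq_eq, norm_sq_eq]
    simp
  · simpa using h2
  · simpa using h3

theorem halfTwist_of_le (σ : ℤˣ) {p : E3} (h : p 1 ≤ -(1 / 2)) : halfTwist σ p = p := by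
  have ha : angle (p 1) = 0 := by
    rw [angle, Real.smoothTransition.zero_of_nonpos (by linarith), mul_zero]
  rw [halfTwist_apply, twistFun, ha]
  ext i; fin_cases i <;> simp

theorem halfTwist_of_ge (σ : ℤˣ) {p : E3} (h : 1 / 2 ≤ p 1) :
    halfTwist σ p = !₂[-p 0, p 1, -p 2] := by
  have ha : angle (p 1) = Real.pi := by
    rw [angle, Real.smoothTransition.one_of_one_le (by linarith), mul_one]
  rw [halfTwist_apply, twistFun, ha]
  rcases Int.units_eq_one_or σ with rfl | rfl <;> ext i <;> fin_cases i <;> simp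

theorem halfTwist_norm (σ : ℤˣ) (p : E3) : ‖halfTwist σ p‖ = ‖p‖ := twistFun_norm _ p

theorem swirl_halfTwist {q : X4} (hq : q ∈ graphSurface heightA) (σ ε : ℤˣ) :
    swirl ((ε : ℤ) : ℝ) (spin (halfTwist σ) q) ∈
      spin (halfTwist (-σ)) '' graphSurface heightA := by
  have hreach : reach (spin (halfTwist σ) q) = reach q := by
    rw [spin_apply, reach, reach, halfTwist_norm]
  -- Below the twisting region both twists are the identity; above it both are the flip `(x, z) ↦
  -- (-x, -z)`. In these two cases the invariance of the surface under `swirl`, at any angle,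
  -- suffices.
  rcases le_total (q.2 1) (-(1 / 2)) with h | h
  · have h1 : spin (halfTwist σ) q = q := Prod.ext rfl (halfTwist_of_le σ h)
    rw [h1]
    refine ⟨swirl _ q, swirl_mem hq _, Prod.ext rfl (halfTwist_of_le _ ?_)⟩
    exact (swirl_snd_one _ q).trans_le h
  rcases le_total (1 / 2) (q.2 1) with h' | h'
  · have h1 : spin (halfTwist σ) q = (q.1, !₂[-q.2 0, q.2 1, -q.2 2]) :=
      Prod.ext rfl (halfTwist_of_ge σ h')
    rw [h1]
    have h2 := swirl_mem (flip_mem hq) ((ε : ℤ) : ℝ)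
    refine ⟨((swirl _ _).1, _), flip_mem h2, Prod.ext rfl ?_⟩
    rw [spin_apply, halfTwist_of_ge]
    · ext i; fin_cases i <;> simp
    · simpa [swirl_snd_one] using h'
  · have hr : reach q ≤ 5 / 2 := reach_le_of_mem hq (by nlinarith)
    have hr' : reach q < 4 := by linarith
    have hangle : coreAngle ((ε : ℤ) : ℝ) (spin (halfTwist σ) q) = Real.pi * ((ε : ℤ) : ℝ) := by
      rw [coreAngle, hreach, Real.smoothTransition.one_of_one_le (by linarith), mul_one]
    have hcos : Real.cos (Real.pi * ((ε : ℤ) : ℝ)) = -1 := by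
      rcases Int.units_eq_one_or ε with rfl | rfl <;> simp
    have hsin : Real.sin (Real.pi * ((ε : ℤ) : ℝ)) = 0 := by
      rcases Int.units_eq_one_or ε with rfl | rfl <;> simp
    have hz : q.2 2 = 0 := hq.2.1
    -- The preimage under the opposite twist is the point with `t` and `x` negated.
    have hmem : turnCore Real.pi q ∈ graphSurface heightA := by
      have := swirl_mem hq 1
      rwa [swirl_of_lt hr', coreAngle, Real.smoothTransition.one_of_one_le (by linarith), mul_one,
        mul_one] at this
    refine ⟨_, hmem, ?_⟩
    rw [swirl_of_lt (hreach.trans_lt hr'), hangle, turnCore, turnCore, hcos, hsin]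
    refine Prod.ext ?_ ?_
    · simp
    · rw [spin_apply]
      simp only [spin_apply, halfTwist_apply, twistFun]
      ext i; fin_cases i <;> simp [hz]

theorem isotopic_halfTwist : IsotopicRelBoundary (spin (halfTwist 1) '' graphSurface heightA)
    (spin (halfTwist (-1)) '' graphSurface heightA) := by
  have hneg : ContMDiff J5 I4 ∞ (fun q : ℝ × X4 => swirl (-q.1) q.2) := by
    have h : ContDiff ℝ ∞ (fun s : ℝ => -s) := contDiff_neg
    exact smooth_swirl.comp ((h.contMDiff.comp contMDiff_fst).prodMk contMDiff_snd)
  refine isotopic_of_inverse_families swirl (fun s => swirl (-s)) smooth_swirl hneg swirl_neg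
    (fun s q => by simpa using swirl_neg (-s) q) (fun q => ?_) (fun q => ⟨fun h => ?_, ?_⟩)
    ⟨2, by norm_num, fun s q h => swirl_of_ge ?_ s⟩
  · by_cases h : reach q < 4
    · rw [swirl_of_lt h, coreAngle, mul_zero, zero_mul, turnCore_zero]
    · exact swirl_of_ge (by linarith) 0
  · obtain ⟨a, ha, he⟩ := h
    -- The converse inclusion is the same statement for the opposite twist and the opposite
    -- rotation.
    have h1 := swirl_halfTwist ha (-1) (-1)
    rw [he] at h1
    have h2 := swirl_neg 1 q
    simp only [Units.val_neg, Units.val_one, Int.cast_neg, Int.cast_one, neg_neg] at h1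
    rwa [h2] at h1
  · rintro ⟨a, ha, rfl⟩
    simpa using swirl_halfTwist ha 1 1
  · rw [reach]
    nlinarith [chordSq_nonneg q.1]

/-! ### A surface that is symmetric under a quarter turn combined with a half turn of the circle -/

/-- The left hand side of the equation of the symmetric surface. -/
def level (p : ℝ × ℝ) : ℝ := p.2 + ramp (p.2 - p.1 + 2)

theorem level_contDiff : ContDiff ℝ ∞ level :=
  contDiff_snd.add (ramp_contDiff.comp ((contDiff_snd.sub contDiff_fst).add contDiff_const))

theorem level_strictMono (c : ℝ) : StrictMono (fun v => level (c, v)) := fun v v' h =>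
  add_lt_add_of_lt_of_le h (ramp_monotone (by dsimp only; linarith))

theorem level_surjective (c : ℝ) : Function.Surjective (fun v => level (c, v)) := by
  have hc : Continuous (fun v => level (c, v)) :=
    level_contDiff.continuous.comp (Continuous.prodMk_right c)
  refine hc.surjective ?_ ?_
  · refine Filter.tendsto_atTop_mono' _ ?_ (Filter.tendsto_id)
    filter_upwards [Filter.eventually_ge_atTop (c + 10)] with v hv
    simp only [level, id]
    rw [ramp_of_ge (by linarith)]
    linarith
  · refine Filter.tendsto_atBot_mono (fun v => ?_)
      (Filter.tendsto_atBot_add_const_right _ (12 : ℝ) Filter.tendsto_id)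
    have := ramp_le (v - c + 2)
    simpa [level] using this

/-- The solution `v` of `level (c, v) = w`. -/
def levelInv (p : ℝ × ℝ) : ℝ := Function.invFun (fun v => level (p.1, v)) p.2

theorem levelInv_level (c v : ℝ) : levelInv (c, level (c, v)) = v :=
  Function.leftInverse_invFun (level_strictMono c).injective v

theorem level_levelInv (c w : ℝ) : level (c, levelInv (c, w)) = w :=
  Function.rightInverse_invFun (level_surjective c) w

/-- The derivative of `level` in its second variable is at least `1`, as `ramp` is monotone. -/
theorem levelInv_contDiff : ContDiff ℝ ∞ levelInv := by
  rw [contDiff_iff_contDiffAt]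
  rintro ⟨c, w⟩
  obtain ⟨v, rfl⟩ := level_surjective c w
  have hr : HasDerivAt ramp (deriv ramp (v - c + 2)) (v - c + 2) :=
    (ramp_contDiff.differentiable (by simp) _).hasDerivAt
  have h1 : HasDerivAt (fun v : ℝ => v - c + 2) 1 v := ((hasDerivAt_id v).sub_const c).add_const 2
  have hd : HasDerivAt (fun v => level (c, v)) (1 + deriv ramp (v - c + 2) * 1) v :=
    (hasDerivAt_id v).add (HasDerivAt.comp (h₂ := ramp) v hr h1)
  refine contDiffAt_fiberwise_inverse level_contDiff.contDiffAt hd ?_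
    (Filter.Eventually.of_forall fun p => levelInv_level p.1 p.2)
  have := ramp_monotone.deriv_nonneg (x := v - c + 2)
  linarith

/-- The height function of the symmetric surface. -/
def heightM (p : ℝ × ℝ) : ℝ := levelInv (p.1, p.2 + ramp (p.2 + p.1 - 2))

theorem heightM_contDiff : ContDiff ℝ ∞ heightM :=
  levelInv_contDiff.comp (contDiff_fst.prodMk (contDiff_snd.add
    (ramp_contDiff.comp ((contDiff_snd.add contDiff_fst).sub contDiff_const))))

theorem eq_heightM_iff {c u v : ℝ} :
    v = heightM (c, u) ↔ v + ramp (v - c + 2) = u + ramp (u + c - 2) := by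
  constructor
  · rintro rfl
    exact level_levelInv c _
  · intro h
    exact (levelInv_level c v).symm.trans (congrArg (fun w => levelInv (c, w)) h)

/-- Substituting `4 - c` for `c` and swapping `u` and `v` interchanges the two sides of the implicit
equation. -/
theorem eq_heightM_iff_symm {c u v : ℝ} : u = heightM (4 - c, v) ↔ v = heightM (c, u) := by
  rw [eq_heightM_iff, eq_heightM_iff, eq_comm]
  ring_nf

/-- One of `u`, `v` is at least `14`, which puts its `ramp` at the maximal value `12`. The equation
then forces the other variable to be at least as large, so both ramps equal `12` and cancel. -/
theorem eq_heightM_iff_of_ge {c u v : ℝ} (h0 : 0 ≤ c) (h4 : c ≤ 4) (h : 28 ≤ u + v) :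
    v = heightM (c, u) ↔ v = u := by
  rw [eq_heightM_iff]
  have h1 := ramp_le (u + c - 2)
  have h2 := ramp_le (v - c + 2)
  rcases le_total u 14 with hu | hu
  · rw [ramp_of_ge (r := v - c + 2) (by linarith)]
    constructor
    · intro h'
      rw [ramp_of_ge (r := u + c - 2) (by linarith)] at h'
      linarith
    · rintro rfl
      rw [ramp_of_ge (by linarith)]
  · rw [ramp_of_ge (r := u + c - 2) (by linarith)]
    constructor
    · intro h'
      rw [ramp_of_ge (r := v - c + 2) (by linarith)] at h'
      linarith
    · rintro rfl
      rw [ramp_of_ge (by linarith)]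

theorem mem_quarterTurn_image {h : ℝ × ℝ → ℝ} {q : X4} :
    q ∈ spin quarterTurnDiff '' graphSurface h ↔
      ‖q.2‖ ≤ 10 ∧ q.2 2 = 0 ∧ (q.2 0) ^ 2 = h (chordSq q.1, (q.2 1) ^ 2) := by
  constructor
  · rintro ⟨a, ⟨h1, h2, h3⟩, rfl⟩
    refine ⟨?_, h2, ?_⟩
    · simpa using h1
    · simpa [quarterTurn_apply] using h3
  · rintro ⟨h1, h2, h3⟩
    refine ⟨(q.1, !₂[q.2 1, -q.2 0, q.2 2]), ⟨?_, h2, ?_⟩, ?_⟩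
    · refine le_trans (le_of_eq ?_) h1
      rw [← sq_eq_sq₀ (norm_nonneg _) (norm_nonneg _), norm_sq_eq, norm_sq_eq]
      simp
      ring
    · simpa using h3
    · refine Prod.ext rfl ?_
      rw [spin_apply, quarterTurnDiff_apply, quarterTurn_apply]
      ext i; fin_cases i <;> simp

/-- Rotation of the circle, by an angle that decreases to `0` towards the boundary of the disc. -/
def whirl (s : ℝ) (q : X4) : X4 :=
  (q.1 * Circle.exp (Real.pi * s * Real.smoothTransition ((80 - ‖q.2‖ ^ 2) / 50)), q.2)

theorem smooth_whirl : ContMDiff J5 I4 ∞ (fun q : ℝ × X4 => whirl q.1 q.2) := by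
  have h : ContDiff ℝ ∞
      (fun a : ℝ × ℝ => Real.pi * a.1 * Real.smoothTransition ((80 - a.2) / 50)) :=
    (contDiff_const.mul contDiff_fst).mul
      (Real.smoothTransition.contDiff.comp ((contDiff_const.sub contDiff_snd).div_const _))
  have h1 := h.contMDiff.comp (contMDiff_fst.prodMk_space smooth_normSq)
  have : LieGroup (𝓡 1) ∞ Circle := LieGroup.of_le (n := ω) le_top
  exact (smooth_circle.mul (contMDiff_circleExp.comp h1)).prodMk smooth_space

theorem whirl_neg (s : ℝ) (q : X4) : whirl (-s) (whirl s q) = q := by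
  refine Prod.ext ?_ rfl
  simp only [whirl]
  rw [mul_assoc, ← Circle.exp_add, mul_neg, neg_mul, add_neg_cancel, Circle.exp_zero, mul_one]

theorem whirl_of_ge {q : X4} (h : 80 ≤ ‖q.2‖ ^ 2) (s : ℝ) : whirl s q = q := by
  rw [whirl, Real.smoothTransition.zero_of_nonpos (by linarith), mul_zero, Circle.exp_zero, mul_one]

theorem chordSq_mul_exp_pi (w : Circle) : chordSq (w * Circle.exp Real.pi) = 4 - chordSq w := by
  rw [chordSq_eq, chordSq_eq, Circle.coe_mul, Circle.coe_exp, Complex.exp_pi_mul_I]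
  simp
  ring

theorem isotopic_heightM : IsotopicRelBoundary (graphSurface heightM)
    (spin quarterTurnDiff '' graphSurface heightM) := by
  have hneg : ContMDiff J5 I4 ∞ (fun q : ℝ × X4 => whirl (-q.1) q.2) := by
    have h : ContDiff ℝ ∞ (fun s : ℝ => -s) := contDiff_neg
    exact smooth_whirl.comp ((h.contMDiff.comp contMDiff_fst).prodMk contMDiff_snd)
  refine isotopic_of_inverse_families whirl (fun s => whirl (-s)) smooth_whirl hneg whirl_neg
    (fun s q => by simpa using whirl_neg (-s) q) (fun q => by simp [whirl]) (fun q => ?_)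
    ⟨9, by norm_num, fun s q h => whirl_of_ge (by nlinarith) s⟩
  rw [mem_quarterTurn_image, mem_graphSurface]
  refine and_congr_right fun _ => and_congr_right fun hz => ?_
  -- Up to squared norm `30` the circle turns by exactly `π`. Beyond it `x² + y² ≥ 28`, and both
  -- surfaces are `y² = x²` whatever the circle coordinate.
  rcases le_total (‖q.2‖ ^ 2) 30 with h | h
  · have h1 : whirl 1 q = (q.1 * Circle.exp Real.pi, q.2) := by
      rw [whirl, Real.smoothTransition.one_of_one_le (by linarith), mul_one, mul_one]
    rw [h1, chordSq_mul_exp_pi]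
    exact eq_heightM_iff_symm
  · have hz' : q.2 2 = 0 := hz
    rw [norm_sq_eq, hz'] at h
    change (q.2 0) ^ 2 = heightM (chordSq (whirl 1 q).1, (q.2 1) ^ 2) ↔
      (q.2 1) ^ 2 = heightM (chordSq q.1, (q.2 0) ^ 2)
    rw [eq_heightM_iff_of_ge (chordSq_nonneg _) (chordSq_le _) (by linarith),
      eq_heightM_iff_of_ge (chordSq_nonneg _) (chordSq_le _) (by linarith)]
    exact eq_comm

/-! ### Shrinking the height -/

/-- A cutoff function: `1` for `t ≤ 20` and `0` for `t ≥ 30`. -/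
def bump (t : ℝ) : ℝ := Real.smoothTransition ((30 - t) / 10)

theorem bump_of_le {t : ℝ} (h : t ≤ 20) : bump t = 1 :=
  Real.smoothTransition.one_of_one_le (by linarith)

theorem bump_of_ge {t : ℝ} (h : 30 ≤ t) : bump t = 0 :=
  Real.smoothTransition.zero_of_nonpos (by linarith)

theorem bump_nonneg (t : ℝ) : 0 ≤ bump t := Real.smoothTransition.nonneg _

theorem bump_antitone : Antitone bump := fun _ _ h =>
  Real.smoothTransition.monotone (by linarith)

theorem bump_contDiff : ContDiff ℝ ∞ bump :=
  Real.smoothTransition.contDiff.comp ((contDiff_const.sub contDiff_id).div_const _)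

/-- Multiplication of `y` by `exp a`, cut off for large `y`. -/
def squeeze (p : ℝ × ℝ) : ℝ := p.2 * Real.exp (p.1 * bump (p.2 ^ 2))

theorem squeeze_contDiff : ContDiff ℝ ∞ squeeze :=
  contDiff_snd.mul (Real.contDiff_exp.comp
    (contDiff_fst.mul (bump_contDiff.comp (contDiff_snd.pow 2))))

theorem squeeze_of_ge {y : ℝ} (h : 30 ≤ y ^ 2) (a : ℝ) : squeeze (a, y) = y := by
  simp [squeeze, bump_of_ge h]

theorem squeeze_of_le {y : ℝ} (h : y ^ 2 ≤ 20) (a : ℝ) : squeeze (a, y) = y * Real.exp a := by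
  simp [squeeze, bump_of_le h]

theorem squeeze_zero (y : ℝ) : squeeze (0, y) = y := by
  simp [squeeze]

theorem hasDerivAt_squeeze (a y : ℝ) : HasDerivAt (fun y => squeeze (a, y))
    (Real.exp (a * bump (y ^ 2)) * (1 + a * (2 * y ^ 2 * deriv bump (y ^ 2)))) y := by
  have hb : HasDerivAt bump (deriv bump (y ^ 2)) (y ^ 2) :=
    (bump_contDiff.differentiable (by simp) _).hasDerivAt
  have h1 : HasDerivAt (fun y : ℝ => y ^ 2) (2 * y) y := by simpa using hasDerivAt_pow 2 y
  have h2 : HasDerivAt (fun y : ℝ => bump (y ^ 2)) (deriv bump (y ^ 2) * (2 * y)) y :=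
    HasDerivAt.comp (h₂ := bump) y hb h1
  have h := (hasDerivAt_id y).mul (h2.const_mul a).exp
  refine h.congr_deriv ?_
  simp only [id]
  ring

/-- For `a ≤ 0` positivity is immediate, as `bump` decreases. The margin `δ > 0` makes the
admissible exponents an open set containing `0`, as needed for smoothness of the inverse at `a = 0`.
-/
theorem exists_squeeze_deriv_pos : ∃ δ > (0 : ℝ), ∀ a < δ, ∀ y : ℝ,
    0 < Real.exp (a * bump (y ^ 2)) * (1 + a * (2 * y ^ 2 * deriv bump (y ^ 2))) := by
  have hcont : Continuous (deriv bump) := bump_contDiff.continuous_deriv (by simp)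
  have hc : Continuous (fun y : ℝ => 2 * y ^ 2 * deriv bump (y ^ 2)) := by fun_prop
  -- Outside `[-6, 6]` one has `y² > 30`, where `bump` is locally zero.
  obtain ⟨B, hB⟩ := (isCompact_Icc (a := (-6 : ℝ)) (b := 6)).exists_bound_of_continuousOn
    hc.continuousOn
  have hB0 : 0 ≤ B := (norm_nonneg _).trans (hB 0 (by norm_num))
  have hbound : ∀ y : ℝ, |2 * y ^ 2 * deriv bump (y ^ 2)| ≤ B := by
    intro y
    by_cases hy : y ∈ Icc (-6 : ℝ) 6
    · exact hB y hy
    · have h36 : 30 < y ^ 2 := by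
        by_contra! h
        exact hy (abs_le.1 (abs_le_of_sq_le_sq (by linarith) (by norm_num)))
      have : bump =ᶠ[𝓝 (y ^ 2)] fun _ => 0 :=
        (eventually_gt_nhds h36).mono fun t ht => bump_of_ge (le_of_lt ht)
      rw [this.deriv_eq]
      simpa using hB0
  refine ⟨1 / (B + 1), by positivity, fun a ha y => mul_pos (Real.exp_pos _) ?_⟩
  have hneg : 2 * y ^ 2 * deriv bump (y ^ 2) ≤ 0 :=
    mul_nonpos_of_nonneg_of_nonpos (by positivity) bump_antitone.deriv_nonpos
  rcases le_total a 0 with h | h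
  · linarith [mul_nonneg_of_nonpos_of_nonpos h hneg]
  · rw [lt_div_iff₀ (by positivity)] at ha
    have h1 := (abs_le.1 (hbound y)).1
    nlinarith

theorem squeeze_surjective (a : ℝ) : Function.Surjective (fun y => squeeze (a, y)) := by
  have hc : Continuous (fun y => squeeze (a, y)) :=
    squeeze_contDiff.continuous.comp (Continuous.prodMk_right a)
  refine hc.surjective ?_ ?_
  · refine Filter.tendsto_id.congr' ?_
    filter_upwards [Filter.eventually_ge_atTop 6] with y hy
    exact (squeeze_of_ge (y := y) (by nlinarith) a).symm
  · refine Filter.tendsto_id.congr' ?_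
    filter_upwards [Filter.eventually_le_atBot (-6)] with y hy
    exact (squeeze_of_ge (y := y) (by nlinarith) a).symm

/-- The solution `y` of `squeeze (a, y) = w`. -/
def unsqueeze (p : ℝ × ℝ) : ℝ := Function.invFun (fun y => squeeze (p.1, y)) p.2

theorem squeeze_unsqueeze (a w : ℝ) : squeeze (a, unsqueeze (a, w)) = w :=
  Function.rightInverse_invFun (squeeze_surjective a) w

theorem exists_unsqueeze : ∃ δ > (0 : ℝ), ∀ a < δ,
    (∀ y, unsqueeze (a, squeeze (a, y)) = y) ∧ ∀ w, ContDiffAt ℝ ∞ unsqueeze (a, w) := by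
  obtain ⟨δ, hδ, h⟩ := exists_squeeze_deriv_pos
  have hleft : ∀ a < δ, ∀ y, unsqueeze (a, squeeze (a, y)) = y := fun a ha y =>
    Function.leftInverse_invFun (strictMono_of_hasDerivAt_pos (hasDerivAt_squeeze a)
      (h a ha)).injective y
  refine ⟨δ, hδ, fun a ha => ⟨hleft a ha, fun w => ?_⟩⟩
  obtain ⟨y, rfl⟩ := squeeze_surjective a w
  refine contDiffAt_fiberwise_inverse squeeze_contDiff.contDiffAt (hasDerivAt_squeeze a y)
    (h a ha y).ne' ?_
  filter_upwards [(continuous_fst.continuousAt (x := (a, y))).eventually_lt_const ha] with p hp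
  exact hleft p.1 hp p.2

theorem norm_le_ten {p : E3} (h : p 0 ^ 2 + p 1 ^ 2 + p 2 ^ 2 ≤ 100) : ‖p‖ ≤ 10 := by
  rw [← norm_sq_eq] at h
  nlinarith [norm_nonneg p]

section Squeeze

variable {h μ : ℝ × ℝ → ℝ}

/-- The exponent with which the height is shrunk at time `s`. -/
def squeezeExponent (μ : ℝ × ℝ → ℝ) (s : ℝ) (q : X4) : ℝ :=
  Real.smoothTransition s * bump ((q.2 2) ^ 2) * μ (chordSq q.1, (q.2 0) ^ 2)

theorem smooth_squeezeExponent
    (hμ : ∀ c u : ℝ, 0 ≤ c → 0 ≤ u → ContDiffAt ℝ ∞ μ (c, u)) :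
    ContMDiff J5 𝓘(ℝ, ℝ) ∞ (fun q : ℝ × X4 => squeezeExponent μ q.1 q.2) := by
  have h1 : ContMDiff J5 𝓘(ℝ, ℝ) ∞ (fun q : ℝ × X4 => Real.smoothTransition q.1) :=
    Real.smoothTransition.contDiff.contMDiff.comp contMDiff_fst
  have hsq : ContDiff ℝ ∞ (fun x : ℝ => x ^ 2) := contDiff_id.pow 2
  have h2 : ContMDiff J5 𝓘(ℝ, ℝ) ∞ (fun q : ℝ × X4 => bump ((q.2.2 2) ^ 2)) :=
    (bump_contDiff.comp hsq).contMDiff.comp (smooth_coord 2)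
  have h3 : ContMDiff J5 𝓘(ℝ, ℝ) ∞ (fun q : ℝ × X4 => μ (chordSq q.2.1, (q.2.2 0) ^ 2)) := by
    intro q
    exact (hμ _ _ (chordSq_nonneg _) (sq_nonneg _)).contMDiffAt.comp q
      (smooth_chordSq.prodMk_space (hsq.contMDiff.comp (smooth_coord 0))).contMDiffAt
  exact (h1.mul h2).mul h3

/-- Multiplying `y` by `exp μ` multiplies `y²` by `(exp μ)²`. The bound `20` on the height keeps the
surface where the factor is not yet cut off in `y`. -/
theorem isotopic_squeeze (hμ : ∀ c u : ℝ, 0 ≤ c → 0 ≤ u → ContDiffAt ℝ ∞ μ (c, u))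
    (hμ0 : ∀ c u : ℝ, 0 ≤ c → c ≤ 4 → 0 ≤ u → μ (c, u) ≤ 0)
    (hμ15 : ∀ c u : ℝ, 0 ≤ c → c ≤ 4 → 15 ≤ u → μ (c, u) = 0)
    (hh : ∀ c u : ℝ, 0 ≤ c → c ≤ 4 → 0 ≤ u → u ≤ 15 → h (c, u) ≤ 20) :
    IsotopicRelBoundary (graphSurface h)
      (graphSurface (fun p => h p * Real.exp (μ p) ^ 2)) := by
  obtain ⟨δ, hδ, hinv⟩ := exists_unsqueeze
  -- Reparametrising time by `Real.smoothTransition` keeps the exponent nonpositive for every real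
  -- `s`, negative ones included.
  have hexp : ∀ s q, squeezeExponent μ s q < δ := fun s q =>
    lt_of_le_of_lt (mul_nonpos_of_nonneg_of_nonpos
      (mul_nonneg (Real.smoothTransition.nonneg _) (bump_nonneg _))
      (hμ0 _ _ (chordSq_nonneg _) (chordSq_le _) (sq_nonneg _))) hδ
  have hsmooth := smooth_squeezeExponent hμ
  refine isotopic_of_inverse_families
    (fun s q => (q.1, !₂[q.2 0, squeeze (squeezeExponent μ s q, q.2 1), q.2 2]))
    (fun s q => (q.1, !₂[q.2 0, unsqueeze (squeezeExponent μ s q, q.2 1), q.2 2]))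
    ?_ ?_ (fun s q => ?_) (fun s q => ?_) (fun q => ?_) (fun q => ?_)
    ⟨9, by norm_num, fun s q hq => ?_⟩
  · intro q
    refine (smooth_circle q).prodMk (contMDiffAt_vec (smooth_coord 0 q) ?_ (smooth_coord 2 q))
    exact squeeze_contDiff.contMDiff.contMDiffAt.comp q
      ((hsmooth.prodMk_space (smooth_coord 1)).contMDiffAt)
  · intro q
    refine (smooth_circle q).prodMk (contMDiffAt_vec (smooth_coord 0 q) ?_ (smooth_coord 2 q))
    exact ((hinv _ (hexp q.1 q.2)).2 _).contMDiffAt.comp q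
      ((hsmooth.prodMk_space (smooth_coord 1)).contMDiffAt)
  · refine Prod.ext rfl ?_
    have he : squeezeExponent μ s
        (q.1, !₂[q.2 0, squeeze (squeezeExponent μ s q, q.2 1), q.2 2]) =
          squeezeExponent μ s q := rfl
    ext i
    fin_cases i
    · rfl
    · change unsqueeze (squeezeExponent μ s _, squeeze (squeezeExponent μ s q, q.2 1)) = q.2 1
      rw [he, (hinv _ (hexp s q)).1]
    · rfl
  · refine Prod.ext rfl ?_
    have he : squeezeExponent μ s
        (q.1, !₂[q.2 0, unsqueeze (squeezeExponent μ s q, q.2 1), q.2 2]) =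
          squeezeExponent μ s q := rfl
    ext i
    fin_cases i
    · rfl
    · change squeeze (squeezeExponent μ s _, unsqueeze (squeezeExponent μ s q, q.2 1)) = q.2 1
      rw [he, squeeze_unsqueeze]
    · rfl
  · have he : squeezeExponent μ 0 q = 0 := by simp [squeezeExponent]
    rw [he, squeeze_zero]
    refine Prod.ext rfl ?_
    ext i; fin_cases i <;> rfl
  · rw [mem_graphSurface, mem_graphSurface]
    change ‖(!₂[q.2 0, squeeze (squeezeExponent μ 1 q, q.2 1), q.2 2] : E3)‖ ≤ 10 ∧ q.2 2 = 0 ∧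
      squeeze (squeezeExponent μ 1 q, q.2 1) ^ 2 = h (chordSq q.1, (q.2 0) ^ 2) *
        Real.exp (μ (chordSq q.1, (q.2 0) ^ 2)) ^ 2 ↔ _
    by_cases hz : q.2 2 = 0
    swap
    · simp [hz]
    have hc0 := chordSq_nonneg q.1
    have hc4 := chordSq_le q.1
    have hu := sq_nonneg (q.2 0)
    have he : squeezeExponent μ 1 q = μ (chordSq q.1, (q.2 0) ^ 2) := by
      simp [squeezeExponent, hz, bump_of_le]
    rw [he]
    set m := μ (chordSq q.1, (q.2 0) ^ 2) with hm
    rcases le_total 15 ((q.2 0) ^ 2) with h15 | h15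
    · have hm0 : m = 0 := hμ15 _ _ hc0 hc4 h15
      have hq : (!₂[q.2 0, q.2 1, q.2 2] : E3) = q.2 := by ext i; fin_cases i <;> rfl
      rw [hm0, squeeze_zero, Real.exp_zero, one_pow, mul_one, hq]
    · have hm0 : m ≤ 0 := hμ0 _ _ hc0 hc4 hu
      have hle : h (chordSq q.1, (q.2 0) ^ 2) ≤ 20 := hh _ _ hc0 hc4 hu h15
      have hm1 : 0 < Real.exp m ^ 2 := by positivity
      constructor
      · rintro ⟨-, -, h3⟩
        -- If `y² > 20`, the cut-off factor is still at least `exp m`, and the squeezed square would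
        -- exceed `20 (exp m)²`.
        have hy : (q.2 1) ^ 2 ≤ 20 := by
          by_contra! hy
          have hb : bump ((q.2 1) ^ 2) ≤ 1 := Real.smoothTransition.le_one _
          have h4 : Real.exp m ≤ Real.exp (m * bump ((q.2 1) ^ 2)) :=
            Real.exp_le_exp.2 (by nlinarith)
          have h5 : (q.2 1) ^ 2 * Real.exp m ^ 2 ≤ squeeze (m, q.2 1) ^ 2 := by
            rw [squeeze, mul_pow]
            gcongr
          nlinarith
        rw [squeeze_of_le hy, mul_pow] at h3
        refine ⟨norm_le_ten ?_, hz, mul_right_cancel₀ hm1.ne' h3⟩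
        rw [hz]
        linarith
      · rintro ⟨-, -, h3⟩
        have hy : (q.2 1) ^ 2 ≤ 20 := h3.trans_le hle
        rw [squeeze_of_le hy]
        refine ⟨norm_le_ten ?_, hz, ?_⟩
        · have h1 : Real.exp m ^ 2 ≤ 1 := pow_le_one₀ (Real.exp_pos _).le (Real.exp_le_one_iff.2 hm0)
          have h2 := mul_le_mul_of_nonneg_left h1 (sq_nonneg (q.2 1))
          simp only [hz]
          simp
          rw [mul_pow]
          linarith
        · rw [mul_pow, h3]
  -- Either `y²` or `z²` is at least `30`, or `x² ≥ 81 - 60 > 15`; each makes the map trivial.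
  · have h81 : 81 ≤ (q.2 0) ^ 2 + (q.2 1) ^ 2 + (q.2 2) ^ 2 := by
      rw [← norm_sq_eq]
      nlinarith
    have hy : squeeze (squeezeExponent μ s q, q.2 1) = q.2 1 := by
      rcases le_total 30 ((q.2 1) ^ 2) with h1 | h1
      · exact squeeze_of_ge h1 _
      rcases le_total 30 ((q.2 2) ^ 2) with h2 | h2
      · simp [squeezeExponent, bump_of_ge h2, squeeze_zero]
      · rw [squeezeExponent, hμ15 _ _ (chordSq_nonneg _) (chordSq_le _) (by linarith), mul_zero,
          squeeze_zero]
    refine Prod.ext rfl ?_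
    ext i
    fin_cases i
    · rfl
    · exact hy
    · rfl

end Squeeze

/-! ### Comparison of the surface of (a1) with the symmetric surface -/

theorem heightA_of_le {p : ℝ × ℝ} (h : p.1 + p.2 ≤ 9 / 4) (hu : p.2 ≤ 3) :
    heightA p = p.1 + p.2 - 2 := by
  rw [heightA, profile_of_le h, arcShape_of_le (by linarith)]
  ring

theorem heightM_of_le {p : ℝ × ℝ} (h : p.1 + p.2 ≤ 9 / 4) (hu : p.2 ≤ 3) :
    heightM p = p.1 + p.2 - 2 := by
  refine (eq_heightM_iff (c := p.1) (u := p.2) |>.2 ?_).symm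
  rw [ramp_of_le (by linarith), ramp_of_le (by linarith)]
  ring

theorem heightA_pos {p : ℝ × ℝ} (h : 2 < p.1 + p.2) : 0 < heightA p := by
  have h1 := profile_pos h
  have h2 := one_le_arcShape p.2
  rw [heightA]
  linarith

theorem heightM_pos {p : ℝ × ℝ} (h : 2 < p.1 + p.2) (hc : 0 ≤ p.1) : 0 < heightM p := by
  have h1 : 0 ≤ ramp (p.2 + p.1 - 2) := by
    have := ramp_monotone (show (0 : ℝ) ≤ p.2 + p.1 - 2 by linarith)
    rwa [ramp_of_le (by norm_num)] at this
  have h2 := (eq_heightM_iff (c := p.1) (u := p.2)).1 rfl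
  -- Values of `level` are compared: at height `0` it is `2 - c`, which is less than `u`.
  refine (level_strictMono p.1).lt_iff_lt.1 ?_
  change 0 + ramp (0 - p.1 + 2) < heightM p + ramp (heightM p - p.1 + 2)
  rw [h2, ramp_of_le (by linarith)]
  linarith

theorem heightA_le {p : ℝ × ℝ} (hu : p.2 ≤ 15) : heightA p ≤ 20 := by
  have h1 := profile_le_one (p.1 + p.2)
  rw [heightA]
  rcases le_total p.2 1 with h | h
  · rw [arcShape_of_le (by linarith)]
    linarith
  · linarith [arcShape_le h]

theorem heightM_le {p : ℝ × ℝ} (hc : p.1 ≤ 4) (hu : p.2 ≤ 15) : heightM p ≤ 20 := by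
  have h1 := ramp_le (p.2 + p.1 - 2)
  have h2 := (eq_heightM_iff (c := p.1) (u := p.2)).1 rfl
  refine (level_strictMono p.1).le_iff_le.1 ?_
  change heightM p + ramp (heightM p - p.1 + 2) ≤ 20 + ramp (20 - p.1 + 2)
  rw [h2, ramp_of_ge (r := 20 - p.1 + 2) (by linarith)]
  linarith

theorem heightA_of_ge {p : ℝ × ℝ} (hc : 0 ≤ p.1) (hu : 14 ≤ p.2) : heightA p = p.2 := by
  rw [heightA, profile_of_ge (by linarith), arcShape_of_ge (by linarith)]
  ring

theorem heightM_of_ge {p : ℝ × ℝ} (hc : 0 ≤ p.1) (hc' : p.1 ≤ 4) (hu : 14 ≤ p.2) :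
    heightM p = p.2 :=
  ((eq_heightM_iff_of_ge hc hc' (by linarith)).2 rfl).symm

/-- Half the logarithm of the ratio of the two heights. -/
def logRatio (p : ℝ × ℝ) : ℝ := (Real.log (heightM p) - Real.log (heightA p)) / 2

theorem logRatio_of_le {p : ℝ × ℝ} (h : p.1 + p.2 ≤ 9 / 4) (hu : p.2 ≤ 3) : logRatio p = 0 := by
  rw [logRatio, heightM_of_le h hu, heightA_of_le h hu, sub_self, zero_div]

theorem logRatio_of_ge {p : ℝ × ℝ} (hc : 0 ≤ p.1) (hc' : p.1 ≤ 4) (hu : 14 ≤ p.2) :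
    logRatio p = 0 := by
  rw [logRatio, heightM_of_ge hc hc' hu, heightA_of_ge hc hu, sub_self, zero_div]

/-- The logarithms are singular where the heights vanish, but there the two heights coincide and the
difference is identically `0`. This region overlaps the one where both are positive. -/
theorem logRatio_contDiffAt {p : ℝ × ℝ} (hc : 0 ≤ p.1) : ContDiffAt ℝ ∞ logRatio p := by
  rcases lt_or_ge (p.1 + p.2) (9 / 4) with h | h
  · have h1 : ∀ᶠ q : ℝ × ℝ in 𝓝 p, q.1 + q.2 < 9 / 4 :=
      (continuous_fst.add continuous_snd).continuousAt.eventually_lt_const h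
    have h2 : ∀ᶠ q : ℝ × ℝ in 𝓝 p, q.2 < 3 :=
      continuous_snd.continuousAt.eventually_lt_const (by linarith)
    refine (contDiffAt_const (c := (0 : ℝ))).congr_of_eventuallyEq ?_
    filter_upwards [h1, h2] with q hq1 hq2
    exact logRatio_of_le hq1.le hq2.le
  · have h' : 2 < p.1 + p.2 := by linarith
    exact ((heightM_contDiff.contDiffAt.log (heightM_pos h' hc).ne').sub
      (heightA_contDiff.contDiffAt.log (heightA_pos h').ne')).div_const 2

theorem heightM_mul_exp {p : ℝ × ℝ} (hc : 0 ≤ p.1) (a : ℝ) :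
    heightM p * Real.exp (a - logRatio p) ^ 2 = heightA p * Real.exp a ^ 2 := by
  rcases le_total (p.1 + p.2) (9 / 4) with h | h
  · rw [logRatio_of_le h (by linarith), heightM_of_le h (by linarith), heightA_of_le h (by linarith),
      sub_zero]
  · have h' : 2 < p.1 + p.2 := by linarith
    have hM := heightM_pos h' hc
    have hA := heightA_pos h'
    have h1 : Real.exp (a - logRatio p) ^ 2 =
        Real.exp a ^ 2 * (Real.exp (Real.log (heightA p)) / Real.exp (Real.log (heightM p))) := by
      rw [← Real.exp_sub, ← Real.exp_nat_mul, ← Real.exp_nat_mul, ← Real.exp_add, logRatio]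
      congr 1
      push_cast
      ring
    rw [h1, Real.exp_log hM, Real.exp_log hA]
    field_simp

theorem graphSurface_congr {h h' : ℝ × ℝ → ℝ}
    (e : ∀ c u : ℝ, 0 ≤ c → c ≤ 4 → 0 ≤ u → h (c, u) = h' (c, u)) :
    graphSurface h = graphSurface h' := by
  ext q
  rw [mem_graphSurface, mem_graphSurface, e _ _ (chordSq_nonneg _) (chordSq_le _) (sq_nonneg _)]

theorem isotopic_heightA_heightM :
    IsotopicRelBoundary (graphSurface heightA) (graphSurface heightM) := by
  obtain ⟨C, hC⟩ := ((isCompact_Icc (a := (0 : ℝ)) (b := 4)).prod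
    (isCompact_Icc (a := (0 : ℝ)) (b := 14))).exists_bound_of_continuousOn
      (f := logRatio) fun p hp => (logRatio_contDiffAt hp.1.1).continuousAt.continuousWithinAt
  have hC0 : 0 ≤ C := (norm_nonneg _).trans (hC (0, 0) (by simp))
  -- `C` bounds `|logRatio|`. The cutoffs make `μ = -C` for `c + u ≥ 9/4`, `u ≤ 14`, which contains
  -- every place where `logRatio` can be nonzero; hence `μ` and `μ - logRatio` are both nonpositive.
  let μ : ℝ × ℝ → ℝ := fun p =>
    -(C * (Real.smoothTransition (8 * (p.1 + p.2) - 17) * Real.smoothTransition (15 - p.2)))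
  have hμ : ContDiff ℝ ∞ μ :=
    (contDiff_const.mul ((Real.smoothTransition.contDiff.comp
      ((contDiff_const.mul (contDiff_fst.add contDiff_snd)).sub contDiff_const)).mul
        (Real.smoothTransition.contDiff.comp (contDiff_const.sub contDiff_snd)))).neg
  have hμ0 : ∀ p, μ p ≤ 0 := fun p => neg_nonpos.2 (mul_nonneg hC0
    (mul_nonneg (Real.smoothTransition.nonneg _) (Real.smoothTransition.nonneg _)))
  have hμ15 : ∀ p : ℝ × ℝ, 15 ≤ p.2 → μ p = 0 := fun p hp => by
    simp only [μ, Real.smoothTransition.zero_of_nonpos (show 15 - p.2 ≤ 0 by linarith), mul_zero,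
      neg_zero]
  have hμd : ∀ c u : ℝ, 0 ≤ c → c ≤ 4 → 0 ≤ u → μ (c, u) - logRatio (c, u) ≤ 0 := by
    intro c u hc hc' hu
    rcases le_total (c + u) (9 / 4) with h | h
    · rw [logRatio_of_le h (by dsimp only; linarith), sub_zero]
      exact hμ0 _
    rcases le_total 14 u with h' | h'
    · rw [logRatio_of_ge hc hc' h', sub_zero]
      exact hμ0 _
    · have h1 := neg_le_of_abs_le (hC (c, u) ⟨⟨hc, hc'⟩, ⟨hu, h'⟩⟩)
      have h2 : μ (c, u) = -C := by
        simp only [μ, Real.smoothTransition.one_of_one_le (show 1 ≤ 15 - u by linarith),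
          Real.smoothTransition.one_of_one_le (show 1 ≤ 8 * (c + u) - 17 by linarith), mul_one]
      linarith
  have hA := isotopic_squeeze (h := heightA) (μ := μ) (fun _ _ _ _ => hμ.contDiffAt)
    (fun c u _ _ _ => hμ0 (c, u)) (fun c u _ _ h => hμ15 (c, u) h)
    fun c u _ _ _ h => heightA_le h
  have hM := isotopic_squeeze (h := heightM) (μ := fun p => μ p - logRatio p)
    (fun c u hc _ => hμ.contDiffAt.sub (logRatio_contDiffAt hc)) hμd
    (fun c u hc hc' h => by
      simp only [hμ15 (c, u) h, logRatio_of_ge (p := (c, u)) hc hc' (by dsimp only; linarith),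
        sub_zero])
    fun c u _ hc' _ h => heightM_le hc' h
  rw [graphSurface_congr (h := fun p => heightM p * Real.exp (μ p - logRatio p) ^ 2)
    (h' := fun p => heightA p * Real.exp (μ p) ^ 2)
    fun c u hc _ _ => heightM_mul_exp (p := (c, u)) hc (μ (c, u))] at hM
  exact hA.trans hM.symm

/-! ### The isotopies between the diagrams. -/

theorem isotopic_A1_A2 :
    IsotopicRelBoundary (addHandle handleA1) (addHandle handleA2) := by
  rw [addHandle_A2, addHandle_A1]
  exact (isotopic_heightA_heightM.trans isotopic_heightM).trans
    (isotopic_heightA_heightM.symm.spin_image _ quarterTurn.norm_map)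

theorem isotopic_B1_B2 :
    IsotopicRelBoundary (addHandle (handleB 1)) (addHandle (handleB (-1))) := by
  have h := isotopic_A1_A2
  rw [addHandle_B, addHandle_B]
  have h1 := h.symm.spin_image (halfTwist 1) (halfTwist_norm 1)
  have h2 := h.spin_image (halfTwist (-1)) (halfTwist_norm (-1))
  -- The chain is `τ₊(a2)`, `τ₊(a1)`, `τ₋(a1)`, `τ₋(a2)`.
  refine (h1.trans ?_).trans h2
  rw [addHandle_A1]
  exact isotopic_halfTwist

end CrossingSwitch

end

theorem mainTheorem6 :
    -- (a1) is isotopic to (a2)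
    CrossingSwitch.IsotopicRelBoundary (CrossingSwitch.addHandle CrossingSwitch.handleA1)
      (CrossingSwitch.addHandle CrossingSwitch.handleA2) ∧
    -- (b1) is isotopic to (b2), for both arcs running from left to right
    CrossingSwitch.IsotopicRelBoundary (CrossingSwitch.addHandle (CrossingSwitch.handleB 1))
      (CrossingSwitch.addHandle (CrossingSwitch.handleB (-1))) ∧
    -- (b1) is isotopic to (b2), for both arcs running upwards
    CrossingSwitch.IsotopicRelBoundary (CrossingSwitch.addHandle (CrossingSwitch.handleB 1).turn)
      (CrossingSwitch.addHandle (CrossingSwitch.handleB (-1)).turn) := by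
  refine ⟨CrossingSwitch.isotopic_A1_A2, CrossingSwitch.isotopic_B1_B2, ?_⟩
  rw [CrossingSwitch.addHandle_turn, CrossingSwitch.addHandle_turn]
  exact CrossingSwitch.isotopic_B1_B2.spin_image _ CrossingSwitch.quarterTurn.norm_map
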